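/- Let $G=(V,E)$ be a finite simple graph with maximum degree $\Delta\ge 2$, and let $k\ge 1$ be an integer. For a number $d\ge 0$, an anti-$L_d(2,1)$-labeling of $G$ is a function $f:V\to[1,k]$ such that $|f(x)-f(y)|\ge 2d$ whenever $xy\in E$, and $|f(x)-f(y)|\ge d$ whenever $x$ and $y$ are at distance two in $G$. Let $mc^{\lambda}_k(G)$, the anti-$L_d(2,1)$-labeling number of $G$, be the largest number $2d$ such that $G$ has an anti-$L_d(2,1)$-labeling with labels in $[1,k]$. Then this largest number exists, and $$mc^{\lambda}_k(G)\;\ge\;2\left\lfloor\frac{k-1}{\Delta^2+\Delta-2}\right\rfloor .$$ This holds both when the labels and $d$ are allowed to be real numbers, and when the labels and $d$ are required to be integers. -/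

import Mathlib

/-- `f` is an anti-`L_d(2,1)`-labeling of `G` with labels in `[1, k]`: labels of adjacent vertices
differ by at least `2 * d`, labels of vertices at distance two differ by at least `d`.
The ring `R` is the domain of the labels and of `d`; it is used with `R = ℝ` and `R = ℤ`. -/
def IsAntiL21Labeling {R : Type*} [Ring R] [LinearOrder R] {V : Type*}
    (G : SimpleGraph V) (k : ℕ) (d : R) (f : V → R) : Prop :=
  (∀ x, f x ∈ Set.Icc (1 : R) (k : R)) ∧
  (∀ x y, G.Adj x y → 2 * d ≤ |f x - f y|) ∧
  (∀ x y, G.dist x y = 2 → d ≤ |f x - f y|)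

/-- The set of all numbers `2 * d`, with `d` non-negative, such that `G` has an
anti-`L_d(2,1)`-labeling with labels in `[1, k]`. -/
def antiL21Values (R : Type*) [Ring R] [LinearOrder R] {V : Type*}
    (G : SimpleGraph V) (k : ℕ) : Set R :=
  {m | ∃ d : R, 0 ≤ d ∧ m = 2 * d ∧ ∃ f : V → R, IsAntiL21Labeling G k d f}

/-- The anti-`L_d(2,1)`-labeling number of `G`: the largest number `2 * d` such that `G` has an
anti-`L_d(2,1)`-labeling with labels in `[1, k]`, the labels and `d` being elements of `R`. -/
noncomputable def antiL21Number (R : Type*) [Ring R] [ConditionallyCompleteLinearOrder R]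
    {V : Type*} (G : SimpleGraph V) (k : ℕ) : R :=
  sSup (antiL21Values R G k)

/-!
Multiplying a labeling with labels `0, …, L`, in which adjacent vertices have labels at least two
apart and vertices at distance two have different labels, by `d = ⌊(k - 1) / L⌋` and adding one
gives an anti-`L_d(2,1)`-labeling with labels in `[1, k]`. So the bound follows once every graph of
maximum degree at most `Δ` has such a labeling with `L = Δ ^ 2 + Δ - 2`
(`hasLabeling_of_degree_le`). The largest value exists over `ℤ` because the values are bounded by
any edge, and over `ℝ` because they form a compact set (`isCompact_antiL21Values`).

The labeling is built one label class at a time. Class `k` is filled greedily, along a fixed order,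
with unlabelled vertices that have no neighbour in class `k - 1` and no vertex of class `k` within
distance two. A vertex `v` passed over at stage `k` is blocked by a neighbour in class `k - 1` or by
an earlier vertex within distance two in class `k`, and it is blocked in this way at most
`Δ + Δ ^ 2` times. The function `score` counts the possible blocks already used up, among them those
by vertices later in the order, which cannot happen. With `L + 1 = Δ ^ 2 + Δ - 1` classes, a vertex
certainly gets a label if it has two vertices within distance two after it
(`PartialLabeling.hasLabeling`). Ordering the vertices by decreasing distance from the end `r` of an
edge `r s` achieves this for all vertices but `r` and `s` (`exists_frame`).

If `r` has degree less than `Δ`, or `r s` lies in a triangle, then `r` and `s` have few enough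
vertices within distance two for this not to matter (`hasLabeling_of_adj`). Otherwise the graph is
regular and triangle-free. For `Δ = 2` it is a cycle and is labelled explicitly
(`hasLabeling_of_two_regular`). For `Δ ≥ 3` a set `P` of at most five vertices near `r s` is
reserved and labelled by hand in the first stages, so that `r` and `s` collect more blocks than
stages have passed. Whenever the intended label is not available for a reserved vertex, it is so
because of a labelled neighbour, and that neighbour can replace the reserved vertex in the count. A
4-cycle through a vertex lowers the number of vertices within distance two and gives an additional
unit (`Slack`).

This works as long as the graph without `P` is connected. Among all configurations `(P, r, s)`
choose one for which the component of `r` outside `P` is largest. If it missed a vertex, then around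
a neighbour of `P` in the part cut off there would be another configuration that leaves the old
component intact and joins it to a vertex of `P` (`Config.reach_lt`); so the best configuration cuts
off nothing (`Tight.hasLabeling`).
-/

open Finset

/-! ### Filling label classes one after another -/

section Greedy

open Classical

variable {V : Type*}

/-- Distinct vertices that are adjacent or have a common neighbour, i.e. vertices at distance one or
two; such vertices need different labels. -/
def Near (G : SimpleGraph V) (v w : V) : Prop :=
  v ≠ w ∧ (G.Adj v w ∨ ∃ x, G.Adj v x ∧ G.Adj x w)

theorem Near.symm {G : SimpleGraph V} {v w : V} (h : Near G v w) : Near G w v :=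
  ⟨h.1.symm, h.2.elim (fun h => Or.inl h.symm) fun ⟨x, h1, h2⟩ => Or.inr ⟨x, h2.symm, h1.symm⟩⟩

theorem SimpleGraph.Adj.near {G : SimpleGraph V} {v w : V} (h : G.Adj v w) : Near G v w :=
  ⟨h.ne, Or.inl h⟩

theorem Near.of_adj_adj {G : SimpleGraph V} {v x w : V} (h : v ≠ w) (h1 : G.Adj v x)
    (h2 : G.Adj x w) : Near G v w :=
  ⟨h, Or.inr ⟨x, h1, h2⟩⟩

theorem Near.ne {G : SimpleGraph V} {v w : V} (h : Near G v w) : v ≠ w := h.1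

/-- Going through the vertices of `C` by increasing rank and taking each one that is not related to
a vertex taken before gives a set in which every rejected vertex is blocked by an earlier one. -/
theorem exists_greedy_set (R : V → V → Prop) (C : V → Prop) (rank : V → ℕ)
    (hrank : Function.Injective rank) :
    ∃ S : V → Prop, (∀ v, S v → C v) ∧ (∀ v w, S v → S w → v ≠ w → R v w → R w v → False) ∧
      ∀ v, C v → ¬ S v → ∃ w, S w ∧ R v w ∧ rank w < rank v := by
  let S : V → Prop := WellFounded.fix (measure rank).wf
    fun v ih => C v ∧ ∀ w, ∀ h : rank w < rank v, R v w → ¬ ih w h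
  have hS : ∀ v, S v ↔ C v ∧ ∀ w, rank w < rank v → R v w → ¬ S w := by
    intro v
    have := WellFounded.fix_eq (measure rank).wf
      (fun v (ih : ∀ w, rank w < rank v → Prop) =>
        C v ∧ ∀ w, ∀ h : rank w < rank v, R v w → ¬ ih w h) v
    exact iff_of_eq this
  refine ⟨S, fun v hv => ((hS v).1 hv).1, fun v w hv hw hne hvw hwv => ?_, fun v hC hv => ?_⟩
  · rcases lt_or_gt_of_ne (fun h => hne (hrank h)) with h | h
    · exact ((hS w).1 hw).2 v h hwv hv
    · exact ((hS v).1 hv).2 w h hvw hw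
  · rw [hS] at hv
    push Not at hv
    obtain ⟨w, h1, h2, h3⟩ := hv hC
    exact ⟨w, h3, h2, h1⟩

variable [Fintype V]

/-- The vertices at distance one or two from `v`. -/
noncomputable def nearFinset (G : SimpleGraph V) (v : V) : Finset V := {w | Near G v w}

/-- The neighbours of `v`, with classical decidability in place of an instance for `G.Adj`. -/
noncomputable def nbrFinset (G : SimpleGraph V) (v : V) : Finset V := {w | G.Adj v w}

@[simp] theorem mem_nearFinset {G : SimpleGraph V} {v w : V} :
    w ∈ nearFinset G v ↔ Near G v w := by simp [nearFinset]

@[simp] theorem mem_nbrFinset {G : SimpleGraph V} {v w : V} :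
    w ∈ nbrFinset G v ↔ G.Adj v w := by simp [nbrFinset]

/-- A labeling in which the labels `0, …, k - 1` have been given out; the value `k` marks the
vertices without a label. Near labelled vertices have different labels, and the labels of adjacent
labelled vertices are not consecutive. -/
structure PartialLabeling (G : SimpleGraph V) (k : ℕ) (c : V → ℕ) : Prop where
  le : ∀ v, c v ≤ k
  near : ∀ v w, Near G v w → c v = c w → c v = k
  adj : ∀ v w, G.Adj v w → c w = c v + 1 → c w = k

/-- The number of near vertices of `v` that are labelled or belong to `Λ`, plus the number of
neighbours of `v` with a label below `k - 1`. The former each keep one label class from `v`, the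
latter each keep the class of the next label from `v`. In the applications `Λ` is a set of vertices
treated after `v`: they can never block `v`, so they are counted as used up in advance. -/
noncomputable def score (G : SimpleGraph V) (k : ℕ) (c : V → ℕ) (Λ : Finset V) (v : V) : ℕ :=
  #{w ∈ nearFinset G v | c w < k ∨ w ∈ Λ} + #{w ∈ nbrFinset G v | c w + 1 < k}

theorem length_add_length_le_score {G : SimpleGraph V} {k : ℕ} {c : V → ℕ} {Λ : Finset V} {v : V}
    (l m : List V) (hl : l.Nodup) (hm : m.Nodup)
    (hl' : ∀ w ∈ l, Near G v w ∧ (c w < k ∨ w ∈ Λ)) (hm' : ∀ w ∈ m, G.Adj v w ∧ c w + 1 < k) :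
    l.length + m.length ≤ score G k c Λ v := by
  rw [← List.toFinset_card_of_nodup hl, ← List.toFinset_card_of_nodup hm]
  refine Nat.add_le_add (card_le_card fun w hw => ?_) (card_le_card fun w hw => ?_)
  · simpa using hl' w (by simpa using hw)
  · simpa using hm' w (by simpa using hw)

theorem score_le {G : SimpleGraph V} {k : ℕ} {c : V → ℕ} {Λ : Finset V} {v : V} :
    score G k c Λ v ≤ #(nearFinset G v) + #(nbrFinset G v) :=
  Nat.add_le_add (card_filter_le _ _) (card_filter_le _ _)

theorem score_zero {G : SimpleGraph V} {c : V → ℕ} {Λ : Finset V} {v : V}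
    (h : ∀ w ∈ Λ, Near G v w) : #Λ ≤ score G 0 c Λ v := by
  refine le_trans (card_le_card fun w hw => ?_) (Nat.le_add_right _ _)
  simpa [hw] using h w hw

/-- One more label class. The vertices of `T` are forced into the class, the other vertices of `E`
are kept out of it, and the remaining vertices join greedily by rank. A vertex outside `E` that
stays unlabelled has a neighbour with label `k - 1`, or a near vertex in the new class that lies in
`T` or precedes it. -/
theorem PartialLabeling.exists_step {G : SimpleGraph V} {k : ℕ} {c : V → ℕ}
    (hc : PartialLabeling G k c) (E T : Finset V) (rank : V → ℕ)
    (hrank : Function.Injective rank)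
    (hT : ∀ x ∈ T, c x = k ∧ ∀ w, G.Adj x w → c w + 1 ≠ k)
    (hT' : ∀ x ∈ T, ∀ y ∈ T, ¬ Near G x y) :
    ∃ c', PartialLabeling G (k + 1) c' ∧ (∀ v, c v < k → c' v = c v) ∧
      (∀ v, c v = k → k ≤ c' v) ∧
      (∀ v ∈ E, c v = k → (c' v = k ↔ v ∈ T)) ∧
      ∀ v, v ∉ E → c v = k → c' v = k + 1 → (∃ w, G.Adj v w ∧ c w + 1 = k) ∨
        ∃ w, Near G v w ∧ c w = k ∧ c' w = k ∧ (w ∈ T ∨ (w ∉ E ∧ rank w < rank v)) := by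
  obtain ⟨S, hSC, hSi, hSm⟩ := exists_greedy_set (Near G)
    (fun v => v ∉ E ∧ c v = k ∧ (∀ w, G.Adj v w → c w + 1 ≠ k) ∧ ∀ x ∈ T, ¬ Near G v x) rank hrank
  let c' : V → ℕ := fun v => if c v < k then c v else if v ∈ T ∨ S v then k else k + 1
  have h1 : ∀ v, c v < k → c' v = c v := fun v hv => by simp [c', hv]
  have h2 : ∀ v, (v ∈ T ∨ S v) → c v = k ∧ c' v = k := by
    intro v hv
    have : c v = k := hv.elim (fun h => (hT v h).1) fun h => (hSC v h).2.1
    exact ⟨this, by simp [c', this, hv]⟩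
  have h3 : ∀ v, c v = k → ¬ (v ∈ T ∨ S v) → c' v = k + 1 := by
    intro v hv h
    simp [c', hv, h]
  have hcases : ∀ v, (c v < k ∧ c' v = c v) ∨ ((v ∈ T ∨ S v) ∧ c v = k ∧ c' v = k) ∨
      (¬ (v ∈ T ∨ S v) ∧ c v = k ∧ c' v = k + 1) := by
    intro v
    rcases lt_or_eq_of_le (hc.le v) with h | h
    · exact Or.inl ⟨h, h1 v h⟩
    · by_cases hv : v ∈ T ∨ S v
      · exact Or.inr (Or.inl ⟨hv, h2 v hv⟩)
      · exact Or.inr (Or.inr ⟨hv, h, h3 v h hv⟩)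
  have hfree : ∀ v, (v ∈ T ∨ S v) → ∀ w, G.Adj v w → c w + 1 ≠ k := fun v hv =>
    hv.elim (fun h => (hT v h).2) fun h => (hSC v h).2.2.1
  refine ⟨c', ⟨fun v => ?_, fun v w hvw he => ?_, fun v w hvw he => ?_⟩, h1, fun v hv => ?_,
    fun v hE hv => ?_, fun v hE hv hv' => ?_⟩
  · rcases hcases v with h | h | h <;> omega
  · rcases hcases v with h | h | h
    · have := hc.near v w hvw
      rcases hcases w with h' | h' | h' <;> omega
    · rcases hcases w with h' | h' | h'
      · omega
      · exfalso
        rcases h.1 with hv | hv <;> rcases h'.1 with hw | hw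
        · exact hT' v hv w hw hvw
        · exact (hSC w hw).2.2.2 v hv hvw.symm
        · exact (hSC v hv).2.2.2 w hw hvw
        · exact hSi v w hv hw hvw.1 hvw hvw.symm
      · omega
    · omega
  · rcases hcases v with h | h | h
    · rcases hcases w with h' | h' | h'
      · have := hc.adj v w hvw (by omega)
        omega
      · exact absurd (by omega) (hfree w h'.1 v hvw.symm)
      · omega
    · rcases hcases w with h' | h' | h' <;> omega
    · rcases hcases w with h' | h' | h' <;> omega
  · rcases hcases v with h | h | h <;> omega
  · have hS : ¬ S v := fun h => (hSC v h).1 hE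
    rcases hcases v with h | h | h
    · omega
    · simp only [hS, or_false] at h
      simp [h]
    · simp only [hS, or_false] at h
      simp [h]
  · have hn : ¬ (v ∈ T ∨ S v) := fun h => by have := h2 v h; omega
    push Not at hn
    by_cases ha : ∃ w, G.Adj v w ∧ c w + 1 = k
    · exact Or.inl ha
    push Not at ha
    right
    by_cases hb : ∃ x ∈ T, Near G v x
    · obtain ⟨x, hx, hvx⟩ := hb
      exact ⟨x, hvx, (h2 x (Or.inl hx)).1, (h2 x (Or.inl hx)).2, Or.inl hx⟩
    push Not at hb
    obtain ⟨w, hw, hvw, hr⟩ := hSm v ⟨hE, hv, ha, hb⟩ hn.2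
    exact ⟨w, hvw, (h2 w (Or.inr hw)).1, (h2 w (Or.inr hw)).2, Or.inr ⟨(hSC w hw).1, hr⟩⟩

/-- A vertex that is blocked at a stage gains a unit of score, so an inequality `b + k ≤ score`
carries over to the next stage. A blocking vertex in `Λ` would gain nothing: it has been counted
before. -/
theorem score_step {G : SimpleGraph V} {k : ℕ} {c c' : V → ℕ} {Λ : Finset V} {v : V} {b : ℕ}
    (hkeep : ∀ v, c v < k → c' v = c v)
    (hblock : (∃ w, G.Adj v w ∧ c w + 1 = k) ∨ ∃ w, Near G v w ∧ c w = k ∧ c' w = k ∧ w ∉ Λ)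
    (h : b + k ≤ score G k c Λ v) : b + (k + 1) ≤ score G (k + 1) c' Λ v := by
  have s1 : ({w ∈ nearFinset G v | c w < k ∨ w ∈ Λ} : Finset V) ⊆
      {w ∈ nearFinset G v | c' w < k + 1 ∨ w ∈ Λ} := by
    intro w
    simp only [mem_filter]
    rintro ⟨h1, h2⟩
    refine ⟨h1, h2.imp_left fun h => ?_⟩
    rw [hkeep w h]; omega
  have s2 : ({w ∈ nbrFinset G v | c w + 1 < k} : Finset V) ⊆
      {w ∈ nbrFinset G v | c' w + 1 < k + 1} := by
    intro w
    simp only [mem_filter]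
    rintro ⟨h1, h2⟩
    refine ⟨h1, ?_⟩
    rw [hkeep w (by omega)]; omega
  suffices score G k c Λ v < score G (k + 1) c' Λ v by omega
  unfold score
  rcases hblock with ⟨w, hw, hk⟩ | ⟨w, hw, hk, hk', hΛ⟩
  -- a neighbour with label `k - 1` is counted in the second summand from stage `k + 1` on
  · refine add_lt_add_of_le_of_lt (card_le_card s1) (card_lt_card ?_)
    refine (ssubset_iff_of_subset s2).2 ⟨w, ?_, ?_⟩
    · have := hkeep w (by omega)
      simp [hw]; omega
    · simp [hk]
  · refine add_lt_add_of_lt_of_le (card_lt_card ?_) (card_le_card s2)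
    refine (ssubset_iff_of_subset s1).2 ⟨w, ?_, ?_⟩
    · simp [hw, hk']
    · simp [hk, hΛ]

/-- `G` has a labeling by `0, …, M - 1` in which adjacent vertices get labels that differ by at
least two and vertices at distance two get different labels. Since adjacency is symmetric, it is
enough to exclude `f w = f v + 1`. -/
def HasLabeling (G : SimpleGraph V) (M : ℕ) : Prop :=
  ∃ f : V → ℕ, (∀ v, f v < M) ∧ (∀ v w, Near G v w → f v ≠ f w) ∧
    ∀ v w, G.Adj v w → f w ≠ f v + 1

/-- Completing a partial labeling greedily. The score of a vertex is at most the number of its near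
vertices plus its degree, so a vertex whose score exceeds the stage by `need v` cannot be left
without a label after stage `M`, provided the vertices of `Λ v` come after `v`. -/
theorem PartialLabeling.hasLabeling {G : SimpleGraph V} {k M : ℕ} {c : V → ℕ}
    (hc : PartialLabeling G k c) (hk : k ≤ M) (rank : V → ℕ) (hrank : Function.Injective rank)
    (Λ : V → Finset V) (need : V → ℕ)
    (hΛ : ∀ v, c v = k → ∀ w ∈ Λ v, rank v < rank w)
    (hneed : ∀ v, c v = k → #(nearFinset G v) + #(nbrFinset G v) < need v + M)
    (hscore : ∀ v, c v = k → need v + k ≤ score G k c (Λ v) v) : HasLabeling G M := by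
  suffices ∃ c, PartialLabeling G M c ∧
      ∀ v, c v = M → (#(nearFinset G v) + #(nbrFinset G v) < need v + M ∧
        need v + M ≤ score G M c (Λ v) v) by
    obtain ⟨f, hf, hs⟩ := this
    have hlt : ∀ v, f v < M := by
      intro v
      refine lt_of_le_of_ne (hf.le v) fun h => ?_
      have := hs v h
      have := score_le (G := G) (k := M) (c := f) (Λ := Λ v) (v := v)
      omega
    refine ⟨f, hlt, fun v w h he => ?_, fun v w h he => ?_⟩
    · have := hf.near v w h he
      have := hlt v
      omega
    · have := hf.adj v w h he
      have := hlt w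
      omega
  suffices ∀ n, ∃ c', PartialLabeling G (k + n) c' ∧ ∀ v, c' v = k + n → c v = k ∧
      need v + (k + n) ≤ score G (k + n) c' (Λ v) v by
    obtain ⟨c', h, h'⟩ := this (M - k)
    rw [Nat.add_sub_cancel' hk] at h h'
    exact ⟨c', h, fun v hv => ⟨hneed v (h' v hv).1, (h' v hv).2⟩⟩
  intro n
  induction n with
  | zero => exact ⟨c, hc, fun v hv => ⟨hv, hscore v hv⟩⟩
  | succ n ih =>
    obtain ⟨d, hd, hds⟩ := ih
    obtain ⟨e, he, hkeep, hun, -, hblock⟩ := hd.exists_step ∅ ∅ rank hrank (by simp) (by simp)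
    refine ⟨e, he, fun v hv => ?_⟩
    have hdv : d v = k + n := by
      rcases lt_or_eq_of_le (hd.le v) with h | h
      · have := hkeep v h
        omega
      · exact h
    refine ⟨(hds v hdv).1, ?_⟩
    refine score_step hkeep ?_ (hds v hdv).2
    refine (hblock v (by simp) hdv hv).imp_right ?_
    rintro ⟨w, h1, h2, h3, h4⟩
    refine ⟨w, h1, h2, h3, fun hw => ?_⟩
    have := hΛ v (hds v hdv).1 w hw
    simp at h4
    omega

end Greedy

/-! ### Orders along which all but two vertices have two later near vertices -/

section Frame

open Classical

variable {V : Type*}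

theorem exists_adj_dist_succ {H : SimpleGraph V} {r v : V} (h : H.Reachable r v) (hne : r ≠ v) :
    ∃ w, H.Adj v w ∧ H.Reachable r w ∧ H.dist r v = H.dist r w + 1 := by
  obtain ⟨p, hp⟩ := h.symm.exists_walk_length_eq_dist
  cases p with
  | nil => exact absurd rfl hne
  | @cons _ w _ hw q =>
    have hq : H.Reachable r w := q.reachable.symm
    refine ⟨w, hw, hq, ?_⟩
    have h1 : H.dist v r ≤ H.dist w r + 1 := by
      obtain ⟨q', hq'⟩ := q.reachable.exists_walk_length_eq_dist
      rw [← hq']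
      exact SimpleGraph.dist_le (SimpleGraph.Walk.cons hw q')
    have h2 := SimpleGraph.dist_le q
    simp only [SimpleGraph.Walk.length_cons] at hp
    rw [SimpleGraph.dist_comm, SimpleGraph.dist_comm (u := r) (v := w)]
    omega

variable [Fintype V]

/-- Every function to `ℕ` can be refined to an injective one by breaking ties. -/
theorem exists_injective_rank (f : V → ℕ) :
    ∃ rank : V → ℕ, Function.Injective rank ∧ ∀ v w, f v < f w → rank v < rank w := by
  let e := Fintype.equivFin V
  let n := Fintype.card V
  have hlt : ∀ v w, f v < f w → f v * n + e v < f w * n + e w := by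
    intro v w h
    have h1 : (e v : ℕ) < n := (e v).2
    have h2 : (f v + 1) * n ≤ f w * n := Nat.mul_le_mul_right n h
    rw [add_mul] at h2
    omega
  refine ⟨fun v => f v * n + e v, fun v w h => ?_, hlt⟩
  have h' : f v * n + e v = f w * n + e w := h
  rcases lt_trichotomy (f v) (f w) with h1 | h1 | h1
  · have := hlt v w h1; omega
  · rw [h1] at h'
    exact e.injective (Fin.ext (by omega))
  · have := hlt w v h1; omega

/-- The edges of `G` avoiding `P`. -/
def avoid (G : SimpleGraph V) (P : Finset V) : SimpleGraph V where
  Adj v w := G.Adj v w ∧ v ∉ P ∧ w ∉ P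
  symm := ⟨fun _ _ h => ⟨h.1.symm, h.2.2, h.2.1⟩⟩
  loopless := ⟨fun _ h => h.1.ne rfl⟩

/-- An edge `r s` avoiding the reserved set `P`, with an order of the remaining vertices in which
each vertex `v` has at least two near vertices `Λ v` outside `P` that come after it; `r` and `s`
count as coming after everything else. -/
structure Frame (G : SimpleGraph V) (P : Finset V) (r s : V) (rank : V → ℕ) (Λ : V → Finset V) :
    Prop where
  adj : G.Adj r s
  r_notMem : r ∉ P
  s_notMem : s ∉ P
  inj : Function.Injective rank
  two_le : ∀ v ∉ insert r (insert s P), 2 ≤ #(Λ v)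
  later : ∀ v ∉ insert r (insert s P), ∀ w ∈ Λ v, Near G v w ∧ w ∉ P ∧
    (w = r ∨ w = s ∨ (w ∉ insert r (insert s P) ∧ rank v < rank w))

/-- If `G` without `P` is connected, order its vertices by decreasing distance from `r`: the later
near vertices of `v` are the next two vertices on a shortest path to `r`, or `r` and `s` if `v` is
adjacent to `r`. -/
theorem exists_frame {G : SimpleGraph V} {P : Finset V} {r s : V} (hrs : G.Adj r s) (hr : r ∉ P)
    (hs : s ∉ P) (hreach : ∀ v, v ∉ P → (avoid G P).Reachable r v) :
    ∃ rank Λ, Frame G P r s rank Λ := by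
  let H := avoid G P
  have hreach : ∀ v, v ∉ P → H.Reachable r v := hreach
  let B := univ.sup fun v => H.dist r v
  have hB : ∀ v, H.dist r v ≤ B := fun v => le_sup (f := fun v => H.dist r v) (mem_univ v)
  obtain ⟨rank, hinj, hrank⟩ := exists_injective_rank fun v => B - H.dist r v
  have hrank' : ∀ v w, H.dist r w < H.dist r v → rank v < rank w := by
    intro v w h
    have := hB v
    exact hrank v w (by omega)
  have key : ∀ v, ∃ L : Finset V, v ∉ insert r (insert s P) → 2 ≤ #L ∧ ∀ w ∈ L, Near G v w ∧ w ∉ P ∧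
      (w = r ∨ w = s ∨ (w ∉ insert r (insert s P) ∧ rank v < rank w)) := by
    intro v
    by_cases hv : v ∈ insert r (insert s P)
    · exact ⟨∅, fun h => absurd hv h⟩
    have hv' := hv
    simp only [mem_insert, not_or] at hv
    obtain ⟨hvr, hvs, hvP⟩ := hv
    obtain ⟨p, hvp, hp, hd⟩ := exists_adj_dist_succ (hreach v hvP) (Ne.symm hvr)
    by_cases hpr : r = p
    · subst hpr
      refine ⟨{r, s}, fun _ => ⟨by rw [card_pair hrs.ne], fun w hw => ?_⟩⟩
      simp only [mem_insert, mem_singleton] at hw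
      rcases hw with rfl | rfl
      · exact ⟨hvp.1.near, hr, Or.inl rfl⟩
      · exact ⟨Near.of_adj_adj hvs hvp.1 hrs, hs, Or.inr (Or.inl rfl)⟩
    · obtain ⟨g, hpg, hg, hd'⟩ := exists_adj_dist_succ hp hpr
      have hvg : v ≠ g := by
        rintro rfl
        omega
      refine ⟨{p, g}, fun _ => ⟨by rw [card_pair hpg.1.ne], fun w hw => ?_⟩⟩
      have : Near G v w ∧ w ∉ P ∧ rank v < rank w := by
        simp only [mem_insert, mem_singleton] at hw
        rcases hw with rfl | rfl
        · exact ⟨hvp.1.near, hpg.2.1, hrank' _ _ (by omega)⟩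
        · exact ⟨Near.of_adj_adj hvg hvp.1 hpg.1, hpg.2.2, hrank' _ _ (by omega)⟩
      refine ⟨this.1, this.2.1, ?_⟩
      simp only [mem_insert, not_or]
      have := this.2
      tauto
  choose Λ hΛ using key
  exact ⟨rank, Λ, hrs, hr, hs, hinj, fun v hv => (hΛ v hv).1, fun v hv => (hΛ v hv).2⟩

/-- A partial labeling obtained in the first `k` stages with `r`, `s` and the vertices of `P`
exempted from the greedy rule: `r` and `s` are unlabelled, and each unlabelled vertex outside `P ∪
{r, s}` still has two units of score to spare, which is all that a vertex can ever need. -/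
structure Stage (G : SimpleGraph V) (P : Finset V) (r s : V) (Λ : V → Finset V) (k : ℕ)
    (c : V → ℕ) : Prop extends PartialLabeling G k c where
  rest : ∀ v ∉ insert r (insert s P), c v = k → 2 + k ≤ score G k c (Λ v) v
  r_eq : c r = k
  s_eq : c s = k

variable {G : SimpleGraph V} {P : Finset V} {r s : V} {rank : V → ℕ} {Λ : V → Finset V}

theorem Frame.stage_zero (F : Frame G P r s rank Λ) : Stage G P r s Λ 0 fun _ => 0 where
  le := by simp
  near := by simp
  adj := by simp
  rest v hv _ := (F.two_le v hv).trans (score_zero fun w hw => (F.later v hv w hw).1)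
  r_eq := rfl
  s_eq := rfl

/-- A stage in which the vertices of `T ⊆ P` are labelled by hand and all other vertices of `P` are
passed over. -/
theorem Frame.stage_succ (F : Frame G P r s rank Λ) {k : ℕ} {c : V → ℕ}
    (hc : Stage G P r s Λ k c) (T : Finset V) (hTP : T ⊆ P)
    (hT : ∀ x ∈ T, c x = k ∧ ∀ w, G.Adj x w → c w + 1 ≠ k)
    (hT' : ∀ x ∈ T, ∀ y ∈ T, ¬ Near G x y) :
    ∃ c', Stage G P r s Λ (k + 1) c' ∧ (∀ v, c v < k → c' v = c v) ∧
      (∀ v ∈ T, c' v = k) ∧ (∀ v ∈ P, c v = k → v ∉ T → c' v = k + 1) := by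
  have hE : ∀ x ∈ P, x ∈ insert r (insert s P) := fun x hx => by simp [hx]
  obtain ⟨c', hc', hkeep, hge, hTE, hblock⟩ := hc.exists_step (insert r (insert s P)) T rank F.inj
    hT hT'
  have hunl : ∀ v ∈ insert r (insert s P), c v = k → v ∉ T → c' v = k + 1 := by
    intro v hv hk hvT
    have h1 := hge v hk
    have h2 := hc'.le v
    have h3 := (hTE v hv hk).not.2 hvT
    omega
  have hrT : r ∉ T := fun h => F.r_notMem (hTP h)
  have hsT : s ∉ T := fun h => F.s_notMem (hTP h)
  refine ⟨c', ⟨hc', fun v hv hk => ?_, hunl r (by simp) hc.r_eq hrT, hunl s (by simp) hc.s_eq hsT⟩,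
    hkeep, fun v hv => (hTE v (hE v (hTP hv)) (hT v hv).1).2 hv, fun v hv => hunl v (hE v hv)⟩
  have hk' : c v = k := by
    rcases lt_or_eq_of_le (hc.le v) with h | h
    · have := hkeep v h
      omega
    · exact h
  refine score_step hkeep ?_ (hc.rest v hv hk')
  refine (hblock v hv hk' hk).imp_right ?_
  rintro ⟨w, h1, h2, h3, h4⟩
  refine ⟨w, h1, h2, h3, fun hw => ?_⟩
  have h5 := F.later v hv w hw
  rcases h4 with h4 | h4
  · exact h5.2.1 (hTP h4)
  · rcases h5.2.2 with rfl | rfl | h5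
    · simp at h4
    · simp at h4
    · omega

/-- The vertices of the list can be treated last, in this order: each one without a label has enough
score when the vertices after it in the list are counted as later. -/
def Endgame (G : SimpleGraph V) (M k : ℕ) (c : V → ℕ) : List V → Prop
  | [] => True
  | v :: t => (c v = k → ∃ n, #(nearFinset G v) + #(nbrFinset G v) < n + M ∧
      n + k ≤ score G k c t.toFinset v) ∧ Endgame G M k c t

theorem Endgame.exists_need {M k : ℕ} {c : V → ℕ} {L : List V} (h : Endgame G M k c L)
    (hL : L.Nodup) {v : V} (hv : v ∈ L) (hk : c v = k) :
    ∃ n, #(nearFinset G v) + #(nbrFinset G v) < n + M ∧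
      n + k ≤ score G k c {w ∈ L.toFinset | L.idxOf v < L.idxOf w} v := by
  induction L with
  | nil => simp at hv
  | cons x t ih =>
    by_cases hx : v = x
    · subst hx
      obtain ⟨n, h1, h2⟩ := h.1 hk
      refine ⟨n, h1, h2.trans ?_⟩
      refine Nat.add_le_add_right (card_le_card fun w hw => ?_) _
      simp only [mem_filter, List.mem_toFinset] at hw ⊢
      refine ⟨hw.1, hw.2.imp_right fun h => ?_⟩
      have : w ≠ v := fun e => (List.nodup_cons.1 hL).1 (e ▸ h)
      simp [h, List.idxOf_cons_ne _ this.symm]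
    · have hvt : v ∈ t := by simpa [hx] using hv
      obtain ⟨n, h1, h2⟩ := ih h.2 (List.nodup_cons.1 hL).2 hvt
      refine ⟨n, h1, h2.trans ?_⟩
      refine Nat.add_le_add_right (card_le_card fun w hw => ?_) _
      simp only [mem_filter, List.mem_toFinset] at hw ⊢
      refine ⟨hw.1, hw.2.imp_right fun h => ?_⟩
      have : w ≠ x := fun e => (List.nodup_cons.1 hL).1 (e ▸ h.1)
      simp [h.1, List.idxOf_cons_ne _ this.symm, List.idxOf_cons_ne _ (Ne.symm hx), h.2]

/-- After the stages with prescribed labels the exemption of `P` is lifted, and the final order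
consists of the ordinary vertices, then the unlabelled vertices of `P` that are not in the list `L`,
then `L`. Those left over from `P` are near `r` and `s`, which come later and supply two units of
score. -/
theorem Frame.hasLabeling (F : Frame G P r s rank Λ) {M k : ℕ} {c : V → ℕ}
    (hc : Stage G P r s Λ k c) (hk : k ≤ M)
    (hM : ∀ v, #(nearFinset G v) + #(nbrFinset G v) ≤ M + 1) (L : List V) (hL : L.Nodup)
    (hLE : ∀ x ∈ L, x ∈ insert r (insert s P)) (hrL : r ∈ L) (hsL : s ∈ L)
    (hend : Endgame G M k c L)
    (hleft : ∀ x ∈ P, x ∉ L → c x = k → Near G x r ∧ Near G x s ∧ k ≤ score G k c ∅ x) :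
    HasLabeling G M := by
  let B := univ.sup rank + 1
  have hB : ∀ v, rank v < B := fun v => Nat.lt_succ_of_le (le_sup (f := rank) (mem_univ v))
  let f : V → ℕ := fun v => if v ∈ L then B + 1 + L.idxOf v else if v ∈ P then B else rank v
  have hfL : ∀ v ∈ L, f v = B + 1 + L.idxOf v := fun v hv => by simp [f, hv]
  have hfP : ∀ v ∉ L, v ∈ P → f v = B := fun v hv hP => by simp [f, hv, hP]
  have hfr : ∀ v, v ∉ insert r (insert s P) → f v = rank v := by
    intro v hv
    have h1 : v ∉ L := fun h => hv (hLE v h)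
    have h2 : v ∉ P := fun h => hv (by simp [h])
    simp [f, h1, h2]
  have hE : ∀ v ∉ L, v ∉ P → v ∉ insert r (insert s P) := by
    intro v hv hP h
    simp only [mem_insert] at h
    rcases h with rfl | rfl | h
    exacts [hv hrL, hv hsL, hP h]
  obtain ⟨rk, hinj, hrk⟩ := exists_injective_rank f
  have key : ∀ v, ∃ n : ℕ, ∃ S : Finset V, c v = k → (∀ w ∈ S, rk v < rk w) ∧
      #(nearFinset G v) + #(nbrFinset G v) < n + M ∧ n + k ≤ score G k c S v := by
    intro v
    by_cases hv : c v = k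
    swap
    · exact ⟨0, ∅, fun h => absurd h hv⟩
    by_cases hvL : v ∈ L
    · obtain ⟨n, h1, h2⟩ := hend.exists_need hL hvL hv
      refine ⟨n, _, fun _ => ⟨fun w hw => hrk _ _ ?_, h1, h2⟩⟩
      simp only [mem_filter, List.mem_toFinset] at hw
      rw [hfL v hvL, hfL w hw.1]
      omega
    by_cases hvP : v ∈ P
    · obtain ⟨h1, h2, h3⟩ := hleft v hvP hvL hv
      refine ⟨2, {r, s}, fun _ => ⟨fun w hw => hrk _ _ ?_, by have := hM v; omega, ?_⟩⟩
      · have hw : w ∈ L := by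
          simp only [mem_insert, mem_singleton] at hw
          rcases hw with rfl | rfl <;> assumption
        rw [hfP v hvL hvP, hfL w hw]
        omega
      · have : (({w ∈ nearFinset G v | c w < k ∨ w ∈ (∅ : Finset V)} : Finset V) ∪ {r, s}) ⊆
            {w ∈ nearFinset G v | c w < k ∨ w ∈ ({r, s} : Finset V)} := by
          intro w hw
          simp only [mem_union, mem_filter, mem_insert, mem_singleton, mem_nearFinset,
            notMem_empty, or_false] at hw ⊢
          rcases hw with hw | rfl | rfl
          · exact ⟨hw.1, Or.inl hw.2⟩
          · exact ⟨h1, Or.inr (Or.inl rfl)⟩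
          · exact ⟨h2, Or.inr (Or.inr rfl)⟩
        have h4 := card_le_card this
        rw [card_union_of_disjoint, card_pair F.adj.ne] at h4
        · unfold score at h3 ⊢
          omega
        · rw [disjoint_right]
          intro w hw
          have : c w = k := by
            simp only [mem_insert, mem_singleton] at hw
            rcases hw with rfl | rfl
            exacts [hc.r_eq, hc.s_eq]
          simp [this]
    · have hvE := hE v hvL hvP
      refine ⟨2, Λ v, fun _ => ⟨fun w hw => hrk _ _ ?_, by have := hM v; omega, hc.rest v hvE hv⟩⟩
      rw [hfr v hvE]
      rcases (F.later v hvE w hw).2.2 with rfl | rfl | h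
      · rw [hfL _ hrL]; have := hB v; omega
      · rw [hfL _ hsL]; have := hB v; omega
      · rw [hfr w h.1]; exact h.2
  choose need S hS using key
  exact hc.hasLabeling hk rk hinj S need (fun v hv => (hS v hv).1) (fun v hv => (hS v hv).2.1)
    fun v hv => (hS v hv).2.2

/-! ### Counting near vertices -/

/-- The near vertices of `v` are found in the sets consisting of a neighbour `w` of `v` and the
neighbours of `w` other than `v`, of size `deg w`. Vertices `Y` common to the sets of two neighbours
are counted twice, which improves the bound. -/
theorem card_near_add_le {v a b : V} (ha : G.Adj v a) (hb : G.Adj v b)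
    (hab : a ≠ b) (Y : Finset V) (hY : ∀ y ∈ Y, y ≠ v ∧ (y = a ∨ G.Adj a y) ∧ (y = b ∨ G.Adj b y)) :
    #(nearFinset G v) + #Y ≤ ∑ w ∈ nbrFinset G v, #(nbrFinset G w) := by
  let A : V → Finset V := fun w => insert w ((nbrFinset G w).erase v)
  have hA : ∀ w ∈ nbrFinset G v, #(A w) ≤ #(nbrFinset G w) := by
    intro w hw
    rw [mem_nbrFinset] at hw
    refine (card_insert_le _ _).trans ?_
    rw [card_erase_add_one]
    simpa using hw.symm
  have hsub : nearFinset G v ⊆ ((nbrFinset G v).erase a).biUnion A ∪ (A a \ Y) := by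
    intro w hw
    rw [mem_nearFinset] at hw
    have : ∃ x, G.Adj v x ∧ w ∈ A x := by
      rcases hw.2 with h | ⟨x, h1, h2⟩
      · exact ⟨w, h, by simp [A]⟩
      · exact ⟨x, h1, by simp [A, h2, hw.1.symm]⟩
    obtain ⟨x, hx, hwx⟩ := this
    by_cases hxa : x = a
    · subst hxa
      by_cases hwY : w ∈ Y
      · refine mem_union_left _ (mem_biUnion.2 ⟨b, by simp [hb, hab.symm], ?_⟩)
        have := hY w hwY
        simp only [A, mem_insert, mem_erase, mem_nbrFinset]
        tauto
      · exact mem_union_right _ (mem_sdiff.2 ⟨hwx, hwY⟩)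
    · exact mem_union_left _ (mem_biUnion.2 ⟨x, by simp [hx, hxa], hwx⟩)
  have hYA : Y ⊆ A a := by
    intro y hy
    have := hY y hy
    simp only [A, mem_insert, mem_erase, mem_nbrFinset]
    tauto
  have h1 := (card_le_card hsub).trans (card_union_le _ _)
  have h2 : #(((nbrFinset G v).erase a).biUnion A) ≤
      ∑ w ∈ (nbrFinset G v).erase a, #(nbrFinset G w) :=
    card_biUnion_le.trans (sum_le_sum fun w hw => hA w (mem_of_mem_erase hw))
  have h3 := hA a (by simpa using ha)
  have h4 := card_sdiff_add_card_eq_card hYA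
  rw [← add_sum_erase _ _ (show a ∈ nbrFinset G v by simpa using ha)]
  omega

theorem card_near_le (v : V) :
    #(nearFinset G v) ≤ ∑ w ∈ nbrFinset G v, #(nbrFinset G w) := by
  let A : V → Finset V := fun w => insert w ((nbrFinset G w).erase v)
  have hA : ∀ w ∈ nbrFinset G v, #(A w) ≤ #(nbrFinset G w) := by
    intro w hw
    rw [mem_nbrFinset] at hw
    refine (card_insert_le _ _).trans ?_
    rw [card_erase_add_one]
    simpa using hw.symm
  refine (card_le_card ?_).trans (card_biUnion_le.trans (sum_le_sum hA))
  intro w hw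
  rw [mem_nearFinset] at hw
  rw [mem_biUnion]
  rcases hw.2 with h | ⟨x, h1, h2⟩
  · exact ⟨w, by simpa using h, by simp [A]⟩
  · exact ⟨x, by simpa using h1, by simp [A, h2, hw.1.symm]⟩

end Frame

/-! ### Labeling by hand around an edge: reserved sets of two or three vertices -/

section Configurations

open Classical

variable {V : Type*} {G : SimpleGraph V} {P : Finset V} {r s : V} {rank : V → ℕ}
  {Λ : V → Finset V} {M k : ℕ} {c : V → ℕ}

/-- An edge `r s` with two further neighbours `z`, `u` of `r` and a further neighbour `t` of `s`. -/
structure ThreeConfig (G : SimpleGraph V) (r s z u t : V) : Prop where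
  rs : G.Adj r s
  rz : G.Adj r z
  ru : G.Adj r u
  st : G.Adj s t
  zu : z ≠ u
  zs : z ≠ s
  us : u ≠ s
  tr : t ≠ r

theorem ThreeConfig.near {z u t : V} (h : ThreeConfig G r s z u t) :
    Near G r s ∧ Near G r z ∧ Near G r u ∧ Near G r t ∧ Near G s z ∧ Near G s u ∧ Near G s t ∧
      Near G z u :=
  ⟨h.rs.near, h.rz.near, h.ru.near, .of_adj_adj h.tr.symm h.rs h.st,
    .of_adj_adj h.zs.symm h.rs.symm h.rz, .of_adj_adj h.us.symm h.rs.symm h.ru, h.st.near,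
    .of_adj_adj h.zu h.rz.symm h.ru⟩

theorem ThreeConfig.swap {z u t : V} (h : ThreeConfig G r s z u t) : ThreeConfig G r s u z t :=
  ⟨h.rs, h.ru, h.rz, h.st, h.zu.symm, h.us, h.zs, h.tr⟩

variable [Fintype V]

/-- One unit below the general bound `M + 1` of `Tight`; such a vertex needs only one unit of score
to spare. -/
def Slack (G : SimpleGraph V) (M : ℕ) (v : V) : Prop :=
  #(nearFinset G v) + #(nbrFinset G v) ≤ M

/-- The properties of a triangle-free `Δ`-regular graph used by the labelings around an edge, with
`M = Δ ^ 2 + Δ - 1`: two units of score to spare always suffice, and on a 4-cycle one unit does. -/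
structure Tight (G : SimpleGraph V) (M : ℕ) : Prop where
  le : ∀ v, #(nearFinset G v) + #(nbrFinset G v) ≤ M + 1
  slack : ∀ v a b x, a ≠ b → v ≠ x → G.Adj v a → G.Adj v b → G.Adj a x → G.Adj b x → Slack G M v
  triangle_free : ∀ a b c, G.Adj a b → G.Adj b c → ¬ G.Adj a c
  five_le : 5 ≤ M

theorem Endgame.nil : Endgame G M k c [] := trivial

/-- The score of `v` is bounded below by listing near vertices `l` that are labelled or come later,
and neighbours `m` with a label below `k - 1`. -/
theorem Endgame.cons {v : V} {t : List V} (n : ℕ) (l m : List V)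
    (hn : #(nearFinset G v) + #(nbrFinset G v) < n + M) (hlen : n + k ≤ l.length + m.length)
    (h : l.Nodup ∧ m.Nodup ∧ (∀ w ∈ l, Near G v w ∧ (c w < k ∨ w ∈ t)) ∧
      ∀ w ∈ m, G.Adj v w ∧ c w + 1 < k) (ht : Endgame G M k c t) : Endgame G M k c (v :: t) :=
  ⟨fun _ => ⟨n, hn, hlen.trans (length_add_length_le_score l m h.1 h.2.1 (by simpa using h.2.2.1)
    h.2.2.2)⟩, ht⟩

theorem Endgame.cons_two (hM : Tight G M) {v : V} {t : List V} (l m : List V)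
    (hlen : 2 + k ≤ l.length + m.length)
    (h : l.Nodup ∧ m.Nodup ∧ (∀ w ∈ l, Near G v w ∧ (c w < k ∨ w ∈ t)) ∧
      ∀ w ∈ m, G.Adj v w ∧ c w + 1 < k) (ht : Endgame G M k c t) : Endgame G M k c (v :: t) :=
  .cons 2 l m (by have := hM.le v; omega) hlen h ht

theorem Endgame.cons_one {v : V} (hv : Slack G M v) {t : List V} (l m : List V)
    (hlen : 1 + k ≤ l.length + m.length)
    (h : l.Nodup ∧ m.Nodup ∧ (∀ w ∈ l, Near G v w ∧ (c w < k ∨ w ∈ t)) ∧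
      ∀ w ∈ m, G.Adj v w ∧ c w + 1 < k) (ht : Endgame G M k c t) : Endgame G M k c (v :: t) :=
  .cons 1 l m (by unfold Slack at hv; omega) hlen h ht

/-- The condition on left-over vertices in `Frame.hasLabeling`, in the form of `Endgame.cons`. -/
theorem leftover_of_lists {x : V} (l m : List V) (hlen : k ≤ l.length + m.length) (hr : Near G x r)
    (hs : Near G x s)
    (h : l.Nodup ∧ m.Nodup ∧ (∀ w ∈ l, Near G x w ∧ c w < k) ∧
      ∀ w ∈ m, G.Adj x w ∧ c w + 1 < k) :
    Near G x r ∧ Near G x s ∧ k ≤ score G k c ∅ x :=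
  ⟨hr, hs, hlen.trans (length_add_length_le_score l m h.1 h.2.1 (by simpa using h.2.2.1)
    h.2.2.2)⟩

/-- The label `k` can be given to `x ∈ P` unless a neighbour of `x` has label `k - 1`. In that
exceptional case the neighbour is itself a labelled vertex near the neighbours of `x`, which is as
useful. The case distinctions in the labelings by hand are on this alternative. -/
theorem Frame.stage_singleton (F : Frame G P r s rank Λ) (hc : Stage G P r s Λ k c) {x : V}
    (hx : x ∈ P) (hxk : c x = k) (h : ∀ w, G.Adj x w → c w + 1 ≠ k) :
    ∃ c', Stage G P r s Λ (k + 1) c' ∧ (∀ v, c v < k → c' v = c v) ∧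
      c' x = k ∧ (∀ v ∈ P, c v = k → v ≠ x → c' v = k + 1) := by
  obtain ⟨c', h1, h2, h3, h4⟩ := F.stage_succ hc {x} (by simpa using hx)
    (by simpa using ⟨hxk, h⟩) (by simpa using fun h : Near G x x => h.1 rfl)
  exact ⟨c', h1, h2, h3 x (by simp), by simpa using h4⟩

/-- An edge `a b` both of whose ends have slack, with two further neighbours `x`, `y` of `a`
reserved: `x` gets label `0`, and `y` gets label `1` if it can. -/
theorem hasLabeling_of_adj_slack (hM : Tight G M) {a b x y : V} (ha : Slack G M a)
    (hb : Slack G M b) (hab : G.Adj a b) (hxy : x ≠ y) (hax : G.Adj a x) (hay : G.Adj a y)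
    (hxb : x ≠ b) (hyb : y ≠ b)
    (hreach : ∀ v, v ∉ ({x, y} : Finset V) → (avoid G {x, y}).Reachable a v) :
    HasLabeling G M := by
  obtain ⟨rank, Λ, F⟩ := exists_frame hab (by simp [hax.ne, hay.ne]) (by simp [hxb.symm, hyb.symm])
    hreach
  have nax := hax.near
  have nay := hay.near
  have nab := hab.near
  have nbx := Near.of_adj_adj hxb.symm hab.symm hax
  have nby := Near.of_adj_adj hyb.symm hab.symm hay
  have nxy := Near.of_adj_adj hxy hax.symm hay
  obtain ⟨c, hc, -, hx, h4⟩ := F.stage_singleton F.stage_zero (x := x) (by simp) rfl (by simp)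
  have hy := h4 y (by simp) rfl hxy.symm
  by_cases h : ∀ w, G.Adj y w → c w + 1 ≠ 1
  · obtain ⟨c', hc', hk', hy', h4'⟩ := F.stage_singleton hc (x := y) (by simp) hy h
    have hx' := hk' x (by omega)
    refine F.hasLabeling hc' (by have := hM.five_le; omega) hM.le [b, a] ?_ ?_ ?_ ?_
      (.cons_one hb [x, y, a] [] (by simp) ?_ (.cons_one ha [x, y] [x] (by simp) ?_ .nil)) ?_
    all_goals grind [Near.symm, Near.ne]
  · push Not at h
    -- label `1` is denied to `y` by its neighbour `q`
    obtain ⟨q, hyq, hq⟩ := h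
    have hqa : q ≠ a := by have := hc.r_eq; grind
    have hqx : q ≠ x := fun h => hM.triangle_free a x y hax (h ▸ hyq.symm) hay
    have naq := Near.of_adj_adj hqa.symm hay hyq
    refine F.hasLabeling hc (by have := hM.five_le; omega) hM.le [b, a] ?_ ?_ ?_ ?_
      (.cons_one hb [x, a] [] (by simp) ?_ (.cons_one ha [x, q] [] (by simp) ?_ .nil))
      fun v hv hvL hvk => ?_
    iterate 6 (grind [Near.symm, Near.ne])
    have : v = y := by grind
    rw [this]
    exact leftover_of_lists [x] [] (by simp) nay.symm nby.symm (by grind [Near.symm, Near.ne])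

theorem ThreeConfig.t_ne (hM : Tight G M) {z u t : V} (h : ThreeConfig G r s z u t) :
    t ≠ z ∧ t ≠ u :=
  ⟨fun e => hM.triangle_free r s t h.rs h.st (e ▸ h.rz),
    fun e => hM.triangle_free r s t h.rs h.st (e ▸ h.ru)⟩

theorem ThreeConfig.frame {z u t : V} (h : ThreeConfig G r s z u t)
    (hreach : ∀ v, v ∉ ({z, u, t} : Finset V) → (avoid G {z, u, t}).Reachable r v) :
    ∃ rank Λ, Frame G {z, u, t} r s rank Λ :=
  exists_frame h.rs (by simp [h.rz.ne, h.ru.ne, h.tr.symm])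
    (by simp [h.zs.symm, h.us.symm, h.st.ne]) hreach

/-- If `t` and `z` are not near, both get label `0`: a single stage then adds to the scores of `r`
and `s` twice. -/
theorem ThreeConfig.hasLabeling_of_not_near (hM : Tight G M) {z u t : V}
    (h : ThreeConfig G r s z u t) (htz : ¬ Near G t z)
    (hreach : ∀ v, v ∉ ({z, u, t} : Finset V) → (avoid G {z, u, t}).Reachable r v) :
    HasLabeling G M := by
  obtain ⟨rank, Λ, F⟩ := h.frame hreach
  obtain ⟨nrs, nrz, nru, nrt, nsz, nsu, nst, nzu⟩ := h.near
  obtain ⟨hrs, hrz, hru, hst, hzu, hzs, hus, htr⟩ := id h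
  obtain ⟨htz', htu'⟩ := h.t_ne hM
  have h5 := hM.five_le
  obtain ⟨c, hc, -, hT, hP⟩ := F.stage_succ F.stage_zero {z, t} (by grind) (by simp)
    (by grind [Near.symm, Near.ne])
  have hz := hT z (by simp)
  have ht := hT t (by simp)
  have hu := hP u (by simp) rfl (by grind)
  by_cases h1 : ∀ w, G.Adj u w → c w + 1 ≠ 1
  · obtain ⟨d, hd, hk, hu', hP'⟩ := F.stage_singleton hc (x := u) (by simp) hu h1
    have hz' := hk z (by omega)
    have ht' := hk t (by omega)
    refine F.hasLabeling hd (by omega) hM.le [s, r] ?_ ?_ ?_ ?_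
      (.cons_two hM [z, t, u] [t] (by simp) ?_ (.cons_two hM [z, t, u] [z] (by simp) ?_ .nil)) ?_
    all_goals grind [Near.symm, Near.ne]
  push Not at h1
  -- label `1` is denied to `u` by its neighbour `q`
  obtain ⟨q, huq, hq⟩ := h1
  have hqr : q ≠ r := by have := hc.r_eq; grind
  have nrq := Near.of_adj_adj hqr.symm hru huq
  have hqz : q ≠ z := fun e => hM.triangle_free r u z hru (e ▸ huq) hrz
  have hleft : ∀ w ∈ ({z, u, t} : Finset V), w ∉ [s, r] → c w = 0 + 1 →
      Near G w r ∧ Near G w s ∧ 0 + 1 ≤ score G (0 + 1) c ∅ w := by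
    intro w hw _ hwk
    obtain rfl | hwu := eq_or_ne w u
    · exact leftover_of_lists [z] [] (by simp) nru.symm nsu.symm (by grind [Near.symm])
    · grind
  -- the blocking vertex `t` closes a 4-cycle through `r` and `s`
  by_cases hqt : q = t
  · subst hqt
    have hr := hM.slack r u s q hus htr.symm hru hrs huq hst
    have hs := hM.slack s q r u htr hus.symm hst hrs.symm huq.symm hru
    refine F.hasLabeling hc (by omega) hM.le [s, r] ?_ ?_ ?_ ?_
      (.cons_one hs [z, q] [] (by simp) ?_ (.cons_one hr [z, q] [] (by simp) ?_ .nil)) hleft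
    all_goals grind [Near.symm, Near.ne]
  · refine F.hasLabeling hc (by omega) hM.le [s, r] ?_ ?_ ?_ ?_
      (.cons_two hM [z, t, r] [] (by simp) ?_ (.cons_two hM [z, t, q] [] (by simp) ?_ .nil)) hleft
    all_goals grind [Near.symm, Near.ne]

/-- If `r` has slack, `z`, `t` and `u` are labelled in this order as far as the labels `0`, `1`, `2`
are free for them. -/
theorem ThreeConfig.hasLabeling_of_slack_left (hM : Tight G M) {z u t : V}
    (h : ThreeConfig G r s z u t) (ntz : Near G t z) (ntu : Near G t u) (hr : Slack G M r)
    (hreach : ∀ v, v ∉ ({z, u, t} : Finset V) → (avoid G {z, u, t}).Reachable r v) :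
    HasLabeling G M := by
  obtain ⟨rank, Λ, F⟩ := h.frame hreach
  obtain ⟨nrs, nrz, nru, nrt, nsz, nsu, nst, nzu⟩ := h.near
  obtain ⟨hrs, hrz, hru, hst, hzu, hzs, hus, htr⟩ := id h
  have h5 := hM.five_le
  obtain ⟨c, hc, -, hz, hP⟩ := F.stage_singleton F.stage_zero (x := z) (by simp) rfl (by simp)
  have ht := hP t (by simp) rfl ntz.ne
  have hu := hP u (by simp) rfl hzu.symm
  have hcr := hc.r_eq
  have hcs := hc.s_eq
  by_cases h1 : ∀ w, G.Adj t w → c w + 1 ≠ 1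
  · obtain ⟨d, hd, hk, ht', hP'⟩ := F.stage_singleton hc (x := t) (by simp) ht h1
    have hz' := hk z (by omega)
    have hu' := hP' u (by simp) hu ntu.ne.symm
    have hdr := hd.r_eq
    have hds := hd.s_eq
    by_cases h2 : ∀ w, G.Adj u w → d w + 1 ≠ 2
    · obtain ⟨e, he, hk', hu'', -⟩ := F.stage_singleton hd (x := u) (by simp) hu' h2
      have hz'' := hk' z (by omega)
      have ht'' := hk' t (by omega)
      refine F.hasLabeling he (by omega) hM.le [s, r] ?_ ?_ ?_ ?_
        (.cons_two hM [z, u, t, r] [t] (by simp) ?_ (.cons_one hr [z, u, t] [z] (by simp) ?_ .nil))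
        ?_
      all_goals grind [Near.symm, Near.ne]
    push Not at h2
    -- label `2` is denied to `u` by its neighbour `q`
    obtain ⟨q, huq, hq⟩ := h2
    by_cases hqt : q = t
    · subst hqt
      have hs := hM.slack s q r u htr hus.symm hst hrs.symm huq.symm hru
      refine F.hasLabeling hd (by omega) hM.le [s, r] ?_ ?_ ?_ ?_
        (.cons_one hs [z, q, r] [] (by simp) ?_ (.cons_one hr [z, q] [z] (by simp) ?_ .nil))
        fun w hw _ hwk => ?_
      iterate 6 (grind [Near.symm, Near.ne])
      obtain rfl | hwu := eq_or_ne w u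
      · exact leftover_of_lists [z, q] [] (by simp) nru.symm nsu.symm
          (by grind [Near.symm, Near.ne])
      · grind
    · have nuq := huq.near
      refine F.hasLabeling hd (by omega) hM.le [s, u, r] ?_ ?_ ?_ ?_
        (.cons_two hM [z, t, u, r] [] (by simp) ?_ (.cons_two hM [z, t, q, r] [] (by simp) ?_
          (.cons_one hr [z, t] [z] (by simp) ?_ .nil))) ?_
      all_goals grind [Near.symm, Near.ne]
  push Not at h1
  -- label `1` is denied to `t` by its neighbour `q`
  obtain ⟨q, htq, hq⟩ := h1
  have nsq : Near G s q := .of_adj_adj (by grind) hst htq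
  by_cases h2 : ∀ w, G.Adj u w → c w + 1 ≠ 1
  · obtain ⟨d, hd, hk, hu', hP'⟩ := F.stage_singleton hc (x := u) (by simp) hu h2
    have hz' := hk z (by omega)
    have hq' := hk q (by omega)
    have ht' := hP' t (by simp) ht ntu.ne
    by_cases hqz : q = z
    · subst hqz
      have hs := hM.slack s t r q htr hzs.symm hst hrs.symm htq hrz
      refine F.hasLabeling hd (by omega) hM.le [s, r] ?_ ?_ ?_ ?_
        (.cons_one hs [q, u, r] [] (by simp) ?_ (.cons_one hr [q, u] [q] (by simp) ?_ .nil))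
        fun w hw _ hwk => ?_
      iterate 6 (grind [Near.symm, Near.ne])
      obtain rfl | hwt := eq_or_ne w t
      · exact leftover_of_lists [q, u] [] (by simp) nrt.symm nst.symm
          (by grind [Near.symm, Near.ne])
      · grind
    · refine F.hasLabeling hd (by omega) hM.le [s, r] ?_ ?_ ?_ ?_
        (.cons_two hM [z, q, u, r] [] (by simp) ?_ (.cons_one hr [z, u] [z] (by simp) ?_ .nil))
        fun w hw _ hwk => ?_
      iterate 6 (grind [Near.symm, Near.ne])
      obtain rfl | hwt := eq_or_ne w t
      · have := htq.near
        exact leftover_of_lists [z, q] [] (by simp) nrt.symm nst.symm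
            (by grind [Near.symm, Near.ne])
      · grind
  push Not at h2
  -- label `1` is denied to `u` by its neighbour `p`
  obtain ⟨p, hup, hp⟩ := h2
  have nrp : Near G r p := .of_adj_adj (by grind) hru hup
  have hpz : p ≠ z := fun e => hM.triangle_free r u z hru (e ▸ hup) hrz
  have hleft : ∀ w ∈ ({z, u, t} : Finset V), w ∉ [s, r] → c w = 0 + 1 →
      Near G w r ∧ Near G w s ∧ 0 + 1 ≤ score G (0 + 1) c ∅ w := by
    intro w hw _ hwk
    obtain rfl | hwu := eq_or_ne w u
    · exact leftover_of_lists [z] [] (by simp) nru.symm nsu.symm (by grind [Near.symm])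
    obtain rfl | hwt := eq_or_ne w t
    · exact leftover_of_lists [z] [] (by simp) nrt.symm nst.symm (by grind [Near.symm])
    · grind
  by_cases hqz : q = z
  · subst hqz
    have hs := hM.slack s t r q htr hzs.symm hst hrs.symm htq hrz
    refine F.hasLabeling hc (by omega) hM.le [s, r] ?_ ?_ ?_ ?_
      (.cons_one hs [q, r] [] (by simp) ?_ (.cons_one hr [q, p] [] (by simp) ?_ .nil)) hleft
    all_goals grind [Near.symm, Near.ne]
  · refine F.hasLabeling hc (by omega) hM.le [s, r] ?_ ?_ ?_ ?_
      (.cons_two hM [z, q, r] [] (by simp) ?_ (.cons_one hr [z, p] [] (by simp) ?_ .nil)) hleft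
    all_goals grind [Near.symm, Near.ne]

/-- If only `s` has slack, `z`, `u` and `t` are labelled in this order as far as the labels `0`,
`1`, `2` are free for them. -/
theorem ThreeConfig.hasLabeling_of_slack_right (hM : Tight G M) {z u t : V}
    (h : ThreeConfig G r s z u t) (ntz : Near G t z) (ntu : Near G t u) (htz : ¬ G.Adj t z)
    (htu : ¬ G.Adj t u) (hs : Slack G M s)
    (hreach : ∀ v, v ∉ ({z, u, t} : Finset V) → (avoid G {z, u, t}).Reachable r v) :
    HasLabeling G M := by
  obtain ⟨rank, Λ, F⟩ := h.frame hreach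
  obtain ⟨nrs, nrz, nru, nrt, nsz, nsu, nst, nzu⟩ := h.near
  obtain ⟨hrs, hrz, hru, hst, hzu, hzs, hus, htr⟩ := id h
  have h5 := hM.five_le
  obtain ⟨c, hc, -, hz, hP⟩ := F.stage_singleton F.stage_zero (x := z) (by simp) rfl (by simp)
  have ht := hP t (by simp) rfl ntz.ne
  have hu := hP u (by simp) rfl hzu.symm
  have hcr := hc.r_eq
  have hcs := hc.s_eq
  by_cases h1 : ∀ w, G.Adj u w → c w + 1 ≠ 1
  · obtain ⟨d, hd, hk, hu', hP'⟩ := F.stage_singleton hc (x := u) (by simp) hu h1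
    have hz' := hk z (by omega)
    have ht' := hP' t (by simp) ht ntu.ne
    have hdr := hd.r_eq
    have hds := hd.s_eq
    by_cases h2 : ∀ w, G.Adj t w → d w + 1 ≠ 2
    · obtain ⟨e, he, hk', hu'', -⟩ := F.stage_singleton hd (x := t) (by simp) ht' h2
      have hz'' := hk' z (by omega)
      have ht'' := hk' u (by omega)
      refine F.hasLabeling he (by omega) hM.le [s, r] ?_ ?_ ?_ ?_
        (.cons_one hs [z, u, t, r] [] (by simp) ?_
          (.cons_two hM [z, u, t] [z, u] (by simp) ?_ .nil)) ?_
      all_goals grind [Near.symm, Near.ne]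
    push Not at h2
    -- label `2` is denied to `t` by its neighbour `q`
    obtain ⟨q, htq, hq⟩ := h2
    have nsq : Near G s q := .of_adj_adj (by grind) hst htq
    have ntq := htq.near
    have hqu : q ≠ u := fun e => htu (e ▸ htq)
    refine F.hasLabeling hd (by omega) hM.le [r, s] ?_ ?_ ?_ ?_
      (.cons_two hM [z, u, s] [z] (by simp) ?_ (.cons_one hs [z, u, q] [] (by simp) ?_ .nil))
      fun w hw _ hwk => ?_
    iterate 6 (grind [Near.symm, Near.ne])
    obtain rfl | hwt := eq_or_ne w t
    · exact leftover_of_lists [z, q] [] (by simp) nrt.symm nst.symm (by grind [Near.symm, Near.ne])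
    · grind
  push Not at h1
  -- label `1` is denied to `u` by its neighbour `q`
  obtain ⟨q, huq, hq⟩ := h1
  have nrq : Near G r q := .of_adj_adj (by grind) hru huq
  have nuq := huq.near
  have hqz : q ≠ z := fun e => hM.triangle_free r u z hru (e ▸ huq) hrz
  by_cases h2 : ∀ w, G.Adj t w → c w + 1 ≠ 1
  · obtain ⟨d, hd, hk, ht', hP'⟩ := F.stage_singleton hc (x := t) (by simp) ht h2
    have hz' := hk z (by omega)
    have hq' := hk q (by omega)
    have hu' := hP' u (by simp) hu ntu.ne.symm
    refine F.hasLabeling hd (by omega) hM.le [s, r] ?_ ?_ ?_ ?_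
      (.cons_one hs [z, t, r] [] (by simp) ?_ (.cons_two hM [z, q, t] [z] (by simp) ?_ .nil))
      fun w hw _ hwk => ?_
    iterate 6 (grind [Near.symm, Near.ne])
    obtain rfl | hwt := eq_or_ne w u
    · exact leftover_of_lists [z, q] [] (by simp) nru.symm nsu.symm (by grind [Near.symm, Near.ne])
    · grind
  push Not at h2
  -- label `1` is denied to `t` by its neighbour `p`
  obtain ⟨p, htp, hp⟩ := h2
  have nsp : Near G s p := .of_adj_adj (by grind) hst htp
  have hpz : p ≠ z := fun e => htz (e ▸ htp)
  refine F.hasLabeling hc (by omega) hM.le [r, s] ?_ ?_ ?_ ?_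
    (.cons_two hM [z, q, s] [] (by simp) ?_ (.cons_one hs [z, p] [] (by simp) ?_ .nil))
    fun w hw _ hwk => ?_
  iterate 6 (grind [Near.symm, Near.ne])
  obtain rfl | hwu := eq_or_ne w u
  · exact leftover_of_lists [z] [] (by simp) nru.symm nsu.symm (by grind [Near.symm])
  obtain rfl | hwt := eq_or_ne w t
  · exact leftover_of_lists [z] [] (by simp) nrt.symm nst.symm (by grind [Near.symm])
  · grind

theorem ThreeConfig.hasLabeling (hM : Tight G M) {z u t : V} (h : ThreeConfig G r s z u t)
    (h' : ¬ Near G t z ∨ ¬ Near G t u ∨ Slack G M r ∨ Slack G M s)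
    (hreach : ∀ v, v ∉ ({z, u, t} : Finset V) → (avoid G {z, u, t}).Reachable r v) :
    HasLabeling G M := by
  by_cases ntz : Near G t z
  swap
  · exact h.hasLabeling_of_not_near hM ntz hreach
  by_cases ntu : Near G t u
  swap
  · refine h.swap.hasLabeling_of_not_near hM ntu ?_
    rwa [insert_comm]
  by_cases hr : Slack G M r
  · exact h.hasLabeling_of_slack_left hM ntz ntu hr hreach
  refine h.hasLabeling_of_slack_right hM ntz ntu (fun e => hr ?_) (fun e => hr ?_)
    (by tauto) hreach
  · exact hM.slack r z s t h.zs h.tr.symm h.rz h.rs e.symm h.st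
  · exact hM.slack r u s t h.us h.tr.symm h.ru h.rs e.symm h.st

end Configurations

/-! ### Labeling by hand around an edge: reserved sets of four or five vertices -/

section LargeConfigurations

open Classical

variable {V : Type*} [Fintype V] {G : SimpleGraph V} {r s z u t v t₁ t₂ : V} {M : ℕ}

/-- Two further neighbours at both ends of an edge without slack. The vertices of either pair are
near the vertices of the other, so they receive distinct labels; the labels `0, …, 3` are tried on
`z`, `t`, `u`, `v`, and a vertex to which its label is denied by a neighbour `q` is postponed, `q`
taking its place in the score. -/
theorem ThreeConfig.hasLabeling_four (hM : Tight G M) (h : ThreeConfig G r s z u t)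
    (hsv : G.Adj s v) (hvr : v ≠ r) (htv : t ≠ v) (hr : ¬ Slack G M r) (hs : ¬ Slack G M s)
    (ntz : Near G t z) (ntu : Near G t u) (nvz : Near G v z) (nvu : Near G v u)
    (hreach : ∀ w, w ∉ ({z, u, t, v} : Finset V) → (avoid G {z, u, t, v}).Reachable r w) :
    HasLabeling G M := by
  obtain ⟨nrs, nrz, nru, nrt, nsz, nsu, nst, nzu⟩ := h.near
  obtain ⟨hrs, hrz, hru, hst, hzu, hzs, hus, htr⟩ := id h
  obtain ⟨rank, Λ, F⟩ := exists_frame hrs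
    (by simp [hrz.ne, hru.ne, htr.symm, hvr.symm])
    (by simp [hzs.symm, hus.symm, hst.ne, hsv.ne]) hreach
  have nsv := hsv.near
  have nrv := Near.of_adj_adj hvr.symm hrs hsv
  have nvt := Near.of_adj_adj htv.symm hsv.symm hst
  have hC : ∀ x y, G.Adj r x → x ≠ s → G.Adj s y → y ≠ r → ¬ G.Adj y x := fun x y hx hxs hy hyr e =>
    hr (hM.slack r x s y hxs hyr.symm hx hrs e.symm hy)
  have htz := hC z t hrz hzs hst htr
  have htu := hC u t hru hus hst htr
  have hvz := hC z v hrz hzs hsv hvr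
  have hvu := hC u v hru hus hsv hvr
  have h5 := hM.five_le
  obtain ⟨c, hc, -, hz, hP⟩ := F.stage_singleton F.stage_zero (x := z) (by simp) rfl (by simp)
  have ht := hP t (by simp) rfl ntz.ne
  have hu := hP u (by simp) rfl hzu.symm
  have hv := hP v (by simp) rfl nvz.ne
  have hcr := hc.r_eq
  have hcs := hc.s_eq
  by_cases h1 : ∀ w, G.Adj t w → c w + 1 ≠ 1
  · obtain ⟨d, hd, hk, ht', hP'⟩ := F.stage_singleton hc (x := t) (by simp) ht h1
    have hz' := hk z (by omega)
    have hu' := hP' u (by simp) hu ntu.ne.symm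
    have hv' := hP' v (by simp) hv htv.symm
    have hdr := hd.r_eq
    have hds := hd.s_eq
    by_cases h2 : ∀ w, G.Adj u w → d w + 1 ≠ 2
    · obtain ⟨e, he, hk', hu'', hP''⟩ := F.stage_singleton hd (x := u) (by simp) hu' h2
      have hz'' := hk' z (by omega)
      have ht'' := hk' t (by omega)
      have hv'' := hP'' v (by simp) hv' nvu.ne
      have her := he.r_eq
      have hes := he.s_eq
      by_cases h3 : ∀ w, G.Adj v w → e w + 1 ≠ 3
      · obtain ⟨f, hf, hk'', hv''', -⟩ := F.stage_singleton he (x := v) (by simp) hv'' h3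
        have hz3 := hk'' z (by omega)
        have ht3 := hk'' t (by omega)
        have hu3 := hk'' u (by omega)
        refine F.hasLabeling hf (by omega) hM.le [s, r] ?_ ?_ ?_ ?_
          (.cons_two hM [z, t, u, v, r] [t] (by simp) ?_
            (.cons_two hM [z, t, u, v] [z, u] (by simp) ?_ .nil)) ?_
        all_goals try simp only [List.forall_mem_cons]
        all_goals grind [Near.symm, Near.ne]
      push Not at h3
      -- label `3` is denied to `v` by its neighbour `q`
      obtain ⟨q, hvq, hq⟩ := h3
      have nsq : Near G s q := .of_adj_adj (by grind) hsv hvq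
      have nvq := hvq.near
      have hqu : q ≠ u := fun e => hvu (e ▸ hvq)
      refine F.hasLabeling he (by omega) hM.le [r, s] ?_ ?_ ?_ ?_
        (.cons_two hM [z, t, u, s] [z] (by simp) ?_
          (.cons_two hM [z, t, u, q] [t] (by simp) ?_ .nil)) fun w hw _ hwk => ?_
      iterate 6 ((try simp only [List.forall_mem_cons]); grind [Near.symm, Near.ne])
      obtain rfl | hwv := eq_or_ne w v
      · refine leftover_of_lists [z, t, q] [] (by simp) nrv.symm nsv.symm ?_
        simp only [List.forall_mem_cons]
        grind [Near.symm, Near.ne]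
      · grind
    push Not at h2
    -- label `2` is denied to `u` by its neighbour `q`
    obtain ⟨q, huq, hq⟩ := h2
    have nrq : Near G r q := .of_adj_adj (by grind) hru huq
    have nuq := huq.near
    have hqt : q ≠ t := fun e => htu (e ▸ huq).symm
    refine F.hasLabeling hd (by omega) hM.le [v, s, u, r] ?_ ?_ ?_ ?_
      (.cons_two hM [z, t, s, r] [] (by simp) ?_ (.cons_two hM [z, t, u, r] [] (by simp) ?_
        (.cons_two hM [z, t, q, r] [] (by simp) ?_
          (.cons_two hM [z, t, q] [z] (by simp) ?_ .nil)))) ?_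
    all_goals try simp only [List.forall_mem_cons]
    all_goals grind [Near.symm, Near.ne]
  push Not at h1
  -- label `1` is denied to `t` by its neighbour `q`
  obtain ⟨q, htq, hq⟩ := h1
  have nsq : Near G s q := .of_adj_adj (by grind) hst htq
  have ntq := htq.near
  have hqz : q ≠ z := fun e => htz (e ▸ htq)
  by_cases h2 : ∀ w, G.Adj u w → c w + 1 ≠ 1
  · obtain ⟨d, hd, hk, hu', hP'⟩ := F.stage_singleton hc (x := u) (by simp) hu h2
    have hz' := hk z (by omega)
    have hq' := hk q (by omega)
    have ht' := hP' t (by simp) ht ntu.ne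
    have hv' := hP' v (by simp) hv nvu.ne
    have hdr := hd.r_eq
    have hds := hd.s_eq
    by_cases h3 : ∀ w, G.Adj t w → d w + 1 ≠ 2
    · obtain ⟨e, he, hk', ht'', hP''⟩ := F.stage_singleton hd (x := t) (by simp) ht' h3
      have hz'' := hk' z (by omega)
      have hq'' := hk' q (by omega)
      have hu'' := hk' u (by omega)
      refine F.hasLabeling he (by omega) hM.le [s, r] ?_ ?_ ?_ ?_
        (.cons_two hM [z, q, u, t, r] [] (by simp) ?_
          (.cons_two hM [z, u, t] [z, u] (by simp) ?_ .nil)) fun w hw _ hwk => ?_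
      iterate 6 ((try simp only [List.forall_mem_cons]); grind [Near.symm, Near.ne])
      obtain rfl | hwv := eq_or_ne w v
      · refine leftover_of_lists [z, u, t] [] (by simp) nrv.symm nsv.symm ?_
        simp only [List.forall_mem_cons]
        grind [Near.symm, Near.ne]
      · grind
    push Not at h3
    -- label `2` is denied to `t` by its neighbour `p`
    obtain ⟨p, htp, hp⟩ := h3
    have nsp : Near G s p := .of_adj_adj (by grind) hst htp
    have hpu : p ≠ u := fun e => htu (e ▸ htp)
    refine F.hasLabeling hd (by omega) hM.le [r, s] ?_ ?_ ?_ ?_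
      (.cons_two hM [z, u, s] [z] (by simp) ?_
        (.cons_two hM [z, q, u, p] [] (by simp) ?_ .nil)) fun w hw _ hwk => ?_
    iterate 6 ((try simp only [List.forall_mem_cons]); grind [Near.symm, Near.ne])
    obtain rfl | hwv := eq_or_ne w v
    · refine leftover_of_lists [z, u] [] (by simp) nrv.symm nsv.symm ?_
      simp only [List.forall_mem_cons]
      grind [Near.symm, Near.ne]
    obtain rfl | hwv := eq_or_ne w t
    · refine leftover_of_lists [z, u] [] (by simp) nrt.symm nst.symm ?_
      simp only [List.forall_mem_cons]
      grind [Near.symm, Near.ne]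
    · grind
  push Not at h2
  -- label `1` is denied to `u` by its neighbour `p`
  obtain ⟨p, hup, hp⟩ := h2
  have nrp : Near G r p := .of_adj_adj (by grind) hru hup
  have hpz : p ≠ z := fun e => hM.triangle_free r u z hru (e ▸ hup) hrz
  by_cases h3 : ∀ w, G.Adj v w → c w + 1 ≠ 1
  · obtain ⟨d, hd, hk, hv', hP'⟩ := F.stage_singleton hc (x := v) (by simp) hv h3
    have hz' := hk z (by omega)
    have hq' := hk q (by omega)
    have hp' := hk p (by omega)
    have ht' := hP' t (by simp) ht htv
    have hu' := hP' u (by simp) hu nvu.ne.symm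
    refine F.hasLabeling hd (by omega) hM.le [s, r] ?_ ?_ ?_ ?_
      (.cons_two hM [z, q, v, r] [] (by simp) ?_
        (.cons_two hM [z, p, v] [z] (by simp) ?_ .nil)) fun w hw _ hwk => ?_
    iterate 6 ((try simp only [List.forall_mem_cons]); grind [Near.symm, Near.ne])
    obtain rfl | hwv := eq_or_ne w u
    · refine leftover_of_lists [z, v] [] (by simp) nru.symm nsu.symm ?_
      simp only [List.forall_mem_cons]
      grind [Near.symm, Near.ne]
    obtain rfl | hwv := eq_or_ne w t
    · refine leftover_of_lists [z, v] [] (by simp) nrt.symm nst.symm ?_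
      simp only [List.forall_mem_cons]
      grind [Near.symm, Near.ne]
    · grind
  push Not at h3
  -- label `1` is denied to `v` by its neighbour `x`
  obtain ⟨x, hvx, hx⟩ := h3
  have nsx : Near G s x := .of_adj_adj (by grind) hsv hvx
  have hxz : x ≠ z := fun e => hvz (e ▸ hvx)
  have hqx : q ≠ x := fun e => hs (hM.slack s t v q htv nsq.ne hst hsv htq (e ▸ hvx))
  refine F.hasLabeling hc (by omega) hM.le [r, s] ?_ ?_ ?_ ?_
    (.cons_two hM [z, p, s] [] (by simp) ?_
      (.cons_two hM [z, q, x] [] (by simp) ?_ .nil)) fun w hw _ hwk => ?_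
  iterate 6 ((try simp only [List.forall_mem_cons]); grind [Near.symm, Near.ne])
  obtain rfl | hwv := eq_or_ne w v
  · refine leftover_of_lists [z] [] (by simp) nrv.symm nsv.symm ?_
    simp only [List.forall_mem_cons]
    grind [Near.symm, Near.ne]
  obtain rfl | hwv := eq_or_ne w u
  · refine leftover_of_lists [z] [] (by simp) nru.symm nsu.symm ?_
    simp only [List.forall_mem_cons]
    grind [Near.symm, Near.ne]
  obtain rfl | hwv := eq_or_ne w t
  · refine leftover_of_lists [z] [] (by simp) nrt.symm nst.symm ?_
    simp only [List.forall_mem_cons]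
    grind [Near.symm, Near.ne]
  · grind

/-- The configuration for cubic graphs, where reserving all neighbours of `r` and `s` would cut off
the edge `r s`. Instead `t` and its two neighbours other than `s` are reserved. All neighbours of
`t` are then unlabelled after the first stage, so label `1` is certainly free for `t`. -/
theorem ThreeConfig.hasLabeling_five (hM : Tight G M) (h : ThreeConfig G r s z u t)
    (ht₁ : G.Adj t t₁) (ht₂ : G.Adj t t₂) (hs₁ : t₁ ≠ s) (hs₂ : t₂ ≠ s)
    (hN : ∀ w, G.Adj t w → w = s ∨ w = t₁ ∨ w = t₂) (h₁₂ : t₁ ≠ t₂) (hz₁ : G.Adj t₁ z)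
    (hu₂ : G.Adj t₂ u)
    (hreach : ∀ w, w ∉ ({z, u, t, t₁, t₂} : Finset V) →
      (avoid G {z, u, t, t₁, t₂}).Reachable r w) :
    HasLabeling G M := by
  obtain ⟨nrs, nrz, nru, nrt, nsz, nsu, nst, nzu⟩ := h.near
  obtain ⟨htz, htu⟩ := h.t_ne hM
  obtain ⟨hrs, hrz, hru, hst, hzu, hzs, hus, htr⟩ := id h
  have hr₁ : t₁ ≠ r := fun e => hM.triangle_free r s t hrs hst (e ▸ ht₁).symm
  have hr₂ : t₂ ≠ r := fun e => hM.triangle_free r s t hrs hst (e ▸ ht₂).symm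
  have hu₁ : t₁ ≠ u := fun e => hM.triangle_free r u z hru (e ▸ hz₁) hrz
  have hz₂ : t₂ ≠ z := fun e => hM.triangle_free r z u hrz (e ▸ hu₂) hru
  obtain ⟨rank, Λ, F⟩ := exists_frame hrs
    (by simp [hrz.ne, hru.ne, htr.symm, hr₁.symm, hr₂.symm])
    (by simp [hzs.symm, hus.symm, hst.ne, hs₁.symm, hs₂.symm]) hreach
  have nt₁ := ht₁.near
  have nt₂ := ht₂.near
  have nz₁ := hz₁.near
  have nu₂ := hu₂.near
  have n₁₂ := Near.of_adj_adj h₁₂ ht₁.symm ht₂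
  have ntz := Near.of_adj_adj htz ht₁ hz₁
  have ntu := Near.of_adj_adj htu ht₂ hu₂
  have ns₁ := Near.of_adj_adj hs₁.symm hst ht₁
  have ns₂ := Near.of_adj_adj hs₂.symm hst ht₂
  have nr₁ := Near.of_adj_adj hr₁.symm hrz hz₁.symm
  have nr₂ := Near.of_adj_adj hr₂.symm hru hu₂.symm
  have h5 := hM.five_le
  obtain ⟨c, hc, -, hz, hP⟩ := F.stage_singleton F.stage_zero (x := z) (by simp) rfl (by simp)
  have ht := hP t (by simp) rfl htz
  have hu := hP u (by simp) rfl hzu.symm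
  have h1 := hP t₁ (by simp) rfl nz₁.ne
  have h2 := hP t₂ (by simp) rfl hz₂
  have hcs := hc.s_eq
  obtain ⟨d, hd, hk, ht', hP'⟩ := F.stage_singleton hc (x := t) (by simp) ht (by
    intro w hw
    rcases hN w hw with rfl | rfl | rfl <;> omega)
  have hz' := hk z (by omega)
  have hu' := hP' u (by simp) hu htu.symm
  have h1' := hP' t₁ (by simp) h1 nt₁.ne.symm
  have h2' := hP' t₂ (by simp) h2 nt₂.ne.symm
  have hdr := hd.r_eq
  have hds := hd.s_eq
  by_cases h3 : ∀ w, G.Adj u w → d w + 1 ≠ 2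
  swap
  · push Not at h3
    -- label `2` is denied to `u` by its neighbour `q`
    obtain ⟨q, huq, hq⟩ := h3
    have nrq : Near G r q := .of_adj_adj (by grind) hru huq
    have nuq := huq.near
    have nq₂ : Near G t₂ q := .of_adj_adj (by grind) hu₂ huq
    have hqt : q ≠ t := by
      rintro rfl
      rcases hN u huq.symm with e | e | e
      · exact hus e
      · exact hu₁ e.symm
      · exact nu₂.ne e.symm
    refine F.hasLabeling hd (by omega) hM.le [t₁, t₂, s, u, r] ?_ ?_ ?_ ?_
      (.cons_two hM [z, t, s, r] [] (by simp) ?_ (.cons_two hM [t, q, s, r] [] (by simp) ?_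
        (.cons_two hM [z, t, u, r] [] (by simp) ?_ (.cons_two hM [z, t, q, r] [] (by simp) ?_
          (.cons_two hM [z, t, q] [z] (by simp) ?_ .nil))))) ?_
    all_goals try simp only [List.forall_mem_cons]
    all_goals grind [Near.symm, Near.ne]
  obtain ⟨e, he, hk', hu'', hP''⟩ := F.stage_singleton hd (x := u) (by simp) hu' h3
  have hz'' := hk' z (by omega)
  have ht'' := hk' t (by omega)
  have h1'' := hP'' t₁ (by simp) h1' hu₁
  have h2'' := hP'' t₂ (by simp) h2' nu₂.ne
  by_cases h4 : ∀ w, G.Adj t₁ w → e w + 1 ≠ 3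
  · obtain ⟨f, hf, hk'', h13, hP3⟩ := F.stage_singleton he (x := t₁) (by simp) h1'' h4
    have hz3 := hk'' z (by omega)
    have ht3 := hk'' t (by omega)
    have hu3 := hk'' u (by omega)
    refine F.hasLabeling hf (by omega) hM.le [t₂, s, r] ?_ ?_ ?_ ?_
      (.cons_two hM [t, u, t₁, s, r] [t] (by simp) ?_
        (.cons_two hM [z, t, u, t₁, r] [t] (by simp) ?_
          (.cons_two hM [z, t, u, t₁] [z, u] (by simp) ?_ .nil))) ?_
    all_goals try simp only [List.forall_mem_cons]
    all_goals grind [Near.symm, Near.ne, SimpleGraph.Adj.symm]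
  · push Not at h4
    -- label `3` is denied to `t₁` by its neighbour `q`
    obtain ⟨q, hq₁, hq⟩ := h4
    have nq := hq₁.near
    refine F.hasLabeling he (by omega) hM.le [t₂, s, r, t₁] ?_ ?_ ?_ ?_
      (.cons_two hM [t, u, s, r] [t] (by simp) ?_ (.cons_two hM [z, t, u, r] [t] (by simp) ?_
        (.cons_two hM [z, t, u, t₁] [z] (by simp) ?_
          (.cons_two hM [z, t, q] [z, t] (by simp) ?_ .nil)))) ?_
    all_goals try simp only [List.forall_mem_cons]
    all_goals grind [Near.symm, Near.ne, SimpleGraph.Adj.symm]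

end LargeConfigurations

/-! ### Reserved sets that do not disconnect the graph -/

section Connectivity

open Classical

variable {V : Type*} {G : SimpleGraph V} {r s z u t : V} {M : ℕ} {P : Finset V}

/-- The vertices outside `P` that are cut off from `r` by `P`. -/
def CutOff (G : SimpleGraph V) (P : Finset V) (r d : V) : Prop :=
  d ∉ P ∧ ¬ (avoid G P).Reachable r d

theorem CutOff.of_adj {d w : V} (h : CutOff G P r d) (hw : G.Adj d w)
    (hwP : w ∉ P) : CutOff G P r w :=
  ⟨hwP, fun e => h.2 (e.trans (SimpleGraph.Adj.reachable ⟨hw.symm, hwP, h.1⟩))⟩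

theorem notMem_of_reachable {v : V} (hr : r ∉ P) (h : (avoid G P).Reachable r v) : v ∉ P := by
  by_cases hne : r = v
  · exact hne ▸ hr
  · obtain ⟨w, hw, -⟩ := exists_adj_dist_succ h hne
    exact hw.2.1

/-- A set disjoint from the reachable set does not block any path inside it. -/
theorem reachable_of_disjoint {P' : Finset V}
    (h : ∀ x ∈ P', ¬ (avoid G P).Reachable r x) {v : V} (hv : (avoid G P).Reachable r v) :
    (avoid G P').Reachable r v := by
  obtain ⟨n, hn⟩ : ∃ n, (avoid G P).dist r v = n := ⟨_, rfl⟩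
  induction n generalizing v with
  | zero => rw [(hv.dist_eq_zero_iff).1 hn]
  | succ n ih =>
    have hne : r ≠ v := by
      rintro rfl
      simp at hn
    obtain ⟨w, hw, hw', hd⟩ := exists_adj_dist_succ hv hne
    refine (ih hw' (by omega)).trans (SimpleGraph.Adj.reachable ⟨hw.1.symm, ?_, ?_⟩)
    · exact fun e => h w e hw'
    · exact fun e => h v e hv

/-- A path from a cut-off vertex to `r` leaves the cut-off part through `P`. -/
theorem exists_boundary (hconn : G.Preconnected) {w : V} (hw : CutOff G P r w) :
    ∃ p ∈ P, ∃ d, CutOff G P r d ∧ G.Adj d p := by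
  obtain ⟨q⟩ := hconn w r
  obtain ⟨e, -, h1, h2⟩ := q.exists_boundary_dart {d | CutOff G P r d} hw
    fun h => h.2 (SimpleGraph.Reachable.refl r)
  refine ⟨e.snd, ?_, e.fst, h1, e.adj⟩
  by_contra hP
  exact h2 (CutOff.of_adj h1 e.adj hP)

variable [Fintype V]

/-- The reserved sets `P` around an edge `r s` for which a labeling exists as soon as `G` without
`P` is connected. The degree condition in `four` and the closed neighbourhood of `t` in `five` tell
cubic graphs from graphs of larger degree. -/
inductive Config (G : SimpleGraph V) (M : ℕ) : Finset V → V → V → Prop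
  | two {a b x y : V} (ha : Slack G M a) (hb : Slack G M b) (hab : G.Adj a b) (hxy : x ≠ y)
      (hax : G.Adj a x) (hay : G.Adj a y) (hxb : x ≠ b) (hyb : y ≠ b) : Config G M {x, y} a b
  | three {r s z u t : V} (h : ThreeConfig G r s z u t)
      (h' : ¬ Near G t z ∨ ¬ Near G t u ∨ Slack G M r ∨ Slack G M s) : Config G M {z, u, t} r s
  | four {r s z u t v : V} (h : ThreeConfig G r s z u t) (hsv : G.Adj s v) (hvr : v ≠ r)
      (htv : t ≠ v) (hr : ¬ Slack G M r) (hs : ¬ Slack G M s) (ntz : Near G t z)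
      (ntu : Near G t u) (nvz : Near G v z) (nvu : Near G v u) (hdeg : 4 ≤ #(nbrFinset G r)) :
      Config G M {z, u, t, v} r s
  | five {r s z u t t₁ t₂ : V} (h : ThreeConfig G r s z u t) (ht₁ : G.Adj t t₁)
      (ht₂ : G.Adj t t₂) (hs₁ : t₁ ≠ s) (hs₂ : t₂ ≠ s)
      (hN : ∀ w, G.Adj t w → w = s ∨ w = t₁ ∨ w = t₂) (h₁₂ : t₁ ≠ t₂) (hz₁ : G.Adj t₁ z)
      (hu₂ : G.Adj t₂ u) (hr : ¬ Slack G M r) : Config G M {z, u, t, t₁, t₂} r s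

theorem Config.hasLabeling (hM : Tight G M) (h : Config G M P r s)
    (hreach : ∀ v, v ∉ P → (avoid G P).Reachable r v) : HasLabeling G M := by
  cases h with
  | two ha hb hab hxy hax hay hxb hyb =>
    exact hasLabeling_of_adj_slack hM ha hb hab hxy hax hay hxb hyb hreach
  | three h h' => exact h.hasLabeling hM h' hreach
  | four h hsv hvr htv hr hs ntz ntu nvz nvu =>
    exact h.hasLabeling_four hM hsv hvr htv hr hs ntz ntu nvz nvu hreach
  | five h ht₁ ht₂ hs₁ hs₂ hN h₁₂ hz₁ hu₂ =>
    exact h.hasLabeling_five hM ht₁ ht₂ hs₁ hs₂ hN h₁₂ hz₁ hu₂ hreach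

theorem Config.adj_and_notMem (hM : Tight G M) (h : Config G M P r s) :
    G.Adj r s ∧ r ∉ P ∧ s ∉ P := by
  cases h with
  | two ha hb hab hxy hax hay hxb hyb =>
    exact ⟨hab, by simp [hax.ne, hay.ne], by simp [hxb.symm, hyb.symm]⟩
  | three h h' =>
    exact ⟨h.rs, by simp [h.rz.ne, h.ru.ne, h.tr.symm], by simp [h.zs.symm, h.us.symm, h.st.ne]⟩
  | four h hsv hvr htv hr hs ntz ntu nvz nvu =>
    exact ⟨h.rs, by simp [h.rz.ne, h.ru.ne, h.tr.symm, hvr.symm],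
      by simp [h.zs.symm, h.us.symm, h.st.ne, hsv.ne]⟩
  | @five _ _ _ _ t t₁ t₂ h ht₁ ht₂ hs₁ hs₂ hN h₁₂ hz₁ hu₂ =>
    have hr₁ : t₁ ≠ r := by
      rintro rfl
      exact hM.triangle_free t₁ s t h.rs h.st ht₁.symm
    have hr₂ : t₂ ≠ r := by
      rintro rfl
      exact hM.triangle_free t₂ s t h.rs h.st ht₂.symm
    refine ⟨h.rs, ?_, ?_⟩
    · simp only [mem_insert, mem_singleton, not_or]
      exact ⟨h.rz.ne, h.ru.ne, h.tr.symm, hr₁.symm, hr₂.symm⟩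
    · simp [h.zs.symm, h.us.symm, h.st.ne, hs₁.symm, hs₂.symm]

/-- Each reserved vertex is adjacent to `r` or `s`, or to a reserved neighbour `t` of `s` all of
whose neighbours are `s` or reserved. -/
theorem Config.attached (h : Config G M P r s) {p : V} (hp : p ∈ P) :
    G.Adj r p ∨ G.Adj s p ∨ ∃ t ∈ P, G.Adj s t ∧ G.Adj t p ∧ ∀ w, G.Adj t w → w = s ∨ w ∈ P := by
  cases h with
  | two => grind
  | three h h' => have := h.rz; have := h.ru; have := h.st; grind
  | four h hsv => have := h.rz; have := h.ru; have := h.st; grind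
  | @five _ _ _ _ t _ _ h ht₁ ht₂ hs₁ hs₂ hN =>
    have := h.rz; have := h.ru; have := h.st
    simp only [mem_insert, mem_singleton] at hp
    rcases hp with rfl | rfl | rfl | hp
    · exact Or.inl h.rz
    · exact Or.inl h.ru
    · exact Or.inr (Or.inl h.st)
    · refine Or.inr (Or.inr ⟨t, by simp, h.st, ?_, fun w hw => ?_⟩)
      · rcases hp with rfl | rfl <;> assumption
      · rcases hN w hw with rfl | rfl | rfl <;> simp

/-- If one of `t`, `v` is not near both `z` and `u`, or if there is slack, that vertex alone serves
as the reserved neighbour of `s`. -/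
theorem exists_config_of_four (h : ThreeConfig G r s z u t) {v : V} (hsv : G.Adj s v)
    (hvr : v ≠ r) (htv : t ≠ v) (hdeg : 4 ≤ #(nbrFinset G r)) :
    ∃ P, Config G M P r s ∧ P ⊆ {z, u, t, v} := by
  by_cases ht : ¬ Near G t z ∨ ¬ Near G t u ∨ Slack G M r ∨ Slack G M s
  · exact ⟨_, .three h ht, by grind⟩
  have h' : ThreeConfig G r s z u v := ⟨h.rs, h.rz, h.ru, hsv, h.zu, h.zs, h.us, hvr⟩
  by_cases hv : ¬ Near G v z ∨ ¬ Near G v u ∨ Slack G M r ∨ Slack G M s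
  · exact ⟨_, .three h' hv, by grind⟩
  push Not at ht hv
  exact ⟨_, .four h hsv hvr htv ht.2.2.1 ht.2.2.2 ht.1 ht.2.1 hv.1 hv.2.1 hdeg, subset_rfl⟩

theorem exists_nbrs {c p : V} (hdeg : #(nbrFinset G c) = 3) (hp : G.Adj c p) :
    ∃ a b, G.Adj c a ∧ G.Adj c b ∧ a ≠ b ∧ a ≠ p ∧ b ≠ p ∧
      ∀ w, G.Adj c w → w = p ∨ w = a ∨ w = b := by
  have h2 : #((nbrFinset G c).erase p) = 2 := by
    rw [card_erase_of_mem (by simpa using hp), hdeg]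
  obtain ⟨a, b, hab, he⟩ := card_eq_two.1 h2
  have hmem : ∀ w, w ≠ p ∧ G.Adj c w ↔ w = a ∨ w = b := by
    intro w
    have := congrArg (w ∈ ·) he
    simpa using this
  have ha := (hmem a).2 (Or.inl rfl)
  have hb := (hmem b).2 (Or.inr rfl)
  exact ⟨a, b, ha.2, hb.2, hab, ha.1, hb.1, fun w hw => by have := hmem w; tauto⟩

theorem exists_two_nbrs {c : V} (F : Finset V) (hdeg : #F + 2 ≤ #(nbrFinset G c)) :
    ∃ a b, G.Adj c a ∧ G.Adj c b ∧ a ≠ b ∧ a ∉ F ∧ b ∉ F := by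
  have h1 := le_card_sdiff F (nbrFinset G c)
  obtain ⟨a, ha, b, hb, hab⟩ := one_lt_card.1 (show 1 < #(nbrFinset G c \ F) by omega)
  simp only [mem_sdiff, mem_nbrFinset] at ha hb
  exact ⟨a, b, ha.1, hb.1, hab, ha.2, hb.2⟩

/-- If `t` is near both `z` and `u` and there is no slack, the two neighbours of `t` other than `s`
are adjacent to `z` and `u` respectively, since one adjacent to both would close a 4-cycle at `r`.
-/
theorem exists_config_of_cubic (hM : Tight G M) (h : ThreeConfig G r s z u t)
    (hdeg : #(nbrFinset G t) = 3) :
    ∃ P, Config G M P r s ∧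
      ∀ x ∈ P, x = z ∨ x = u ∨ x = t ∨ (G.Adj x t ∧ (G.Adj x z ∨ G.Adj x u)) := by
  by_cases ht : ¬ Near G t z ∨ ¬ Near G t u ∨ Slack G M r ∨ Slack G M s
  · exact ⟨_, .three h ht, by grind⟩
  push Not at ht
  obtain ⟨ntz, ntu, hr, -⟩ := ht
  have key : ∀ x, G.Adj r x → x ≠ s → Near G t x → ∃ w, G.Adj t w ∧ G.Adj w x ∧ w ≠ s := by
    rintro x hx hxs ⟨-, e | ⟨w, h1, h2⟩⟩
    · exact absurd (hM.slack r x s t hxs h.tr.symm hx h.rs e.symm h.st) hr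
    · exact ⟨w, h1, h2, fun e => hM.triangle_free r s x h.rs (e ▸ h2) hx⟩
  obtain ⟨t₁, h1, hz₁, hs₁⟩ := key z h.rz h.zs ntz
  obtain ⟨t₂, h2, hu₂, hs₂⟩ := key u h.ru h.us ntu
  have hr₁ : t₁ ≠ r := fun e => hM.triangle_free r s t h.rs h.st (e ▸ h1).symm
  have h₁₂ : t₁ ≠ t₂ := by
    rintro rfl
    exact hr (hM.slack r z u t₁ h.zu hr₁.symm h.rz h.ru hz₁.symm hu₂.symm)
  have hN : ∀ w, G.Adj t w → w = s ∨ w = t₁ ∨ w = t₂ := by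
    obtain ⟨a, b, -, -, -, -, -, hab⟩ := exists_nbrs hdeg h.st.symm
    intro w hw
    have := hab w hw
    have := hab t₁ h1
    have := hab t₂ h2
    grind
  refine ⟨_, .five h h1 h2 hs₁ hs₂ hN h₁₂ hz₁ hu₂ hr, ?_⟩
  intro x hx
  simp only [mem_insert, mem_singleton] at hx
  rcases hx with rfl | rfl | rfl | rfl | rfl
  · simp
  · simp
  · simp
  · exact Or.inr (Or.inr (Or.inr ⟨h1.symm, Or.inl hz₁⟩))
  · exact Or.inr (Or.inr (Or.inr ⟨h2.symm, Or.inr hu₂⟩))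

/-- The vertices that can be reached from `r` outside `P`. -/
noncomputable def reach (G : SimpleGraph V) (P : Finset V) (r : V) : Finset V :=
  {v | (avoid G P).Reachable r v}

/-- A new configuration whose reserved vertices all have neighbours cut off by the old one reserves
no vertex reachable from `r`. If `s'` equals or is adjacent to a vertex `p` of the old reserved set
that is not reserved any more, then `p` joins the two sides, and the reachable set grows at least by `p`. -/
theorem Config.reach_lt (hM : Tight G M) (h : Config G M P r s) {P' : Finset V} {r' s' p : V}
    (h' : Config G M P' r' s') (hp : p ∈ P) (hp' : p ∉ P') (hs' : p = s' ∨ G.Adj s' p)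
    (hD : ∀ x ∈ P', ∃ d, CutOff G P r d ∧ G.Adj d x) : #(reach G P r) < #(reach G P' r') := by
  obtain ⟨hrs, hrP, hsP⟩ := h.adj_and_notMem hM
  obtain ⟨hrs', hrP', hsP'⟩ := h'.adj_and_notMem hM
  have hX : ∀ x ∈ P', ¬ (avoid G P).Reachable r x := by
    intro x hx hx'
    obtain ⟨d, hd, hdx⟩ := hD x hx
    exact (hd.of_adj hdx (notMem_of_reachable hrP hx')).2 hx'
  have hrP'' : r ∉ P' := fun e => hX r e (SimpleGraph.Reachable.refl r)
  have hrs₀ : (avoid G P).Reachable r s := SimpleGraph.Adj.reachable ⟨hrs, hrP, hsP⟩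
  have hsP'' : s ∉ P' := fun e => hX s e hrs₀
  have hrs₁ := reachable_of_disjoint hX hrs₀
  have hpX : ¬ (avoid G P).Reachable r p := fun e => notMem_of_reachable hrP e hp
  have hrp : (avoid G P').Reachable r p := by
    rcases h.attached hp with e | e | ⟨t, ht, hst, htp, hN⟩
    · exact SimpleGraph.Adj.reachable ⟨e, hrP'', hp'⟩
    · exact hrs₁.trans (SimpleGraph.Adj.reachable ⟨e, hsP'', hp'⟩)
    · have htP' : t ∉ P' := by
        intro e
        obtain ⟨d, hd, hdt⟩ := hD t e
        rcases hN d hdt.symm with rfl | e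
        · exact hd.2 hrs₀
        · exact hd.1 e
      exact (hrs₁.trans (SimpleGraph.Adj.reachable ⟨hst, hsP'', htP'⟩)).trans
        (SimpleGraph.Adj.reachable ⟨htp, htP', hp'⟩)
  have hrp' : (avoid G P').Reachable r' p := by
    have h1 : (avoid G P').Reachable r' s' := SimpleGraph.Adj.reachable ⟨hrs', hrP', hsP'⟩
    rcases hs' with rfl | e
    · exact h1
    · exact h1.trans (SimpleGraph.Adj.reachable ⟨e, hsP', hp'⟩)
  refine card_lt_card ((ssubset_iff_of_subset fun v hv => ?_).2 ⟨p, ?_, ?_⟩)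
  · simp only [reach, mem_filter, mem_univ, true_and] at hv ⊢
    exact (hrp'.trans hrp.symm).trans (reachable_of_disjoint hX hv)
  · simpa [reach] using hrp'
  · simpa [reach] using hpX

/-- If all degrees are at least four and `P` cuts off some vertex, then there is a configuration
with a larger reachable set: take a cut-off vertex `c` with a neighbour `p ∈ P` and a configuration
on an edge `c a` with `a` cut off that does not use `p`. -/
theorem Config.improve_of_four_le (hM : Tight G M) (hdeg : ∀ v, 4 ≤ #(nbrFinset G v))
    (hconn : G.Preconnected) (h : Config G M P r s) {w : V} (hw : CutOff G P r w) :
    ∃ P' r' s', Config G M P' r' s' ∧ #(reach G P r) < #(reach G P' r') := by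
  obtain ⟨hrs, hrP, hsP⟩ := h.adj_and_notMem hM
  obtain ⟨p, hp, c, hc, hcp⟩ := exists_boundary hconn hw
  have : ∃ a, G.Adj c a ∧ a ∉ P := by
    by_contra! hcon
    have hsub : nbrFinset G c ⊆ P := fun x hx => hcon x (by simpa using hx)
    have h4 := (hdeg c).trans (card_le_card hsub)
    cases h with
    | two => have := h4.trans card_le_two; omega
    | three => have := h4.trans card_le_three; omega
    | @four _ _ z u t v h hsv hvr htv hr hs =>
      have he := eq_of_subset_of_card_le hsub (card_le_four.trans (hdeg c))
      have hz : G.Adj c z := by rw [← mem_nbrFinset, he]; simp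
      have hu : G.Adj c u := by rw [← mem_nbrFinset, he]; simp
      refine hr (hM.slack r z u c h.zu ?_ h.rz h.ru hz.symm hu.symm)
      rintro rfl
      exact hc.2 (SimpleGraph.Reachable.refl r)
    | @five _ _ z u t t₁ t₂ h ht₁ ht₂ hs₁ hs₂ hN =>
      have hsub : nbrFinset G t ⊆ {s, t₁, t₂} := fun x hx => by
        simpa using hN x (by simpa using hx)
      have := (hdeg t).trans ((card_le_card hsub).trans card_le_three)
      omega
  obtain ⟨a, hca, haP⟩ := this
  have ha := hc.of_adj hca haP
  have hpa : p ≠ a := fun e => haP (e ▸ hp)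
  obtain ⟨z, u, hz, hu, hzu, hzc, huc⟩ := exists_two_nbrs (G := G) (c := a) {c}
    (by have := hdeg a; simp only [card_singleton]; omega)
  obtain ⟨t, v, ht, hv, htv, htF, hvF⟩ := exists_two_nbrs (G := G) (c := c) {p, a}
    (by have := hdeg c; rw [card_pair hpa]; omega)
  simp only [mem_singleton, mem_insert, not_or] at hzc huc htF hvF
  obtain ⟨P', hP', hsub⟩ := exists_config_of_four (M := M)
    (⟨hca.symm, hz, hu, ht, hzu, hzc, huc, htF.2⟩ : ThreeConfig G a c z u t) hv hvF.2 htv (hdeg a)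
  have hpn : ¬ G.Adj a p := fun e => hM.triangle_free c a p hca e hcp
  refine ⟨P', a, c, hP', h.reach_lt hM hP' hp (fun e => ?_) (Or.inr hcp) fun x hx => ?_⟩
  · have := hsub e
    grind
  · have := hsub hx
    simp only [mem_singleton, mem_insert] at this
    rcases this with rfl | rfl | rfl | rfl
    exacts [⟨a, ha, hz⟩, ⟨a, ha, hu⟩, ⟨c, hc, ht⟩, ⟨c, hc, hv⟩]

/-- A cut-off vertex `c` of a cubic graph with exactly one neighbour `p` in `P`: its other
neighbours carry a configuration avoiding `p`. -/
theorem Config.improve_of_single (hM : Tight G M) (hdeg : ∀ v, #(nbrFinset G v) = 3)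
    (h : Config G M P r s) {p c a b : V} (hp : p ∈ P) (hc : CutOff G P r c) (hcp : G.Adj c p)
    (hca : G.Adj c a) (hcb : G.Adj c b) (hab : a ≠ b) (haP : a ∉ P) (hbP : b ∉ P) :
    ∃ P' r' s', Config G M P' r' s' ∧ #(reach G P r) < #(reach G P' r') := by
  obtain ⟨hrs, hrP, hsP⟩ := h.adj_and_notMem hM
  have ha := hc.of_adj hca haP
  have hb := hc.of_adj hcb hbP
  obtain ⟨z, u, hz, hu, hzu, hzc, huc, -⟩ := exists_nbrs (hdeg a) hca.symm
  obtain ⟨P', hP', hsub⟩ := exists_config_of_cubic hM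
    (⟨hca.symm, hz, hu, hcb, hzu, hzc, huc, hab.symm⟩ : ThreeConfig G a c z u b) (hdeg b)
  have hpa : ¬ G.Adj a p := fun e => hM.triangle_free c a p hca e hcp
  have hpb : ¬ G.Adj b p := fun e => hM.triangle_free c b p hcb e hcp
  refine ⟨P', a, c, hP', h.reach_lt hM hP' hp (fun e => ?_) (Or.inr hcp) fun x hx => ?_⟩
  · rcases hsub p e with rfl | rfl | rfl | h
    exacts [hpa hz, hpa hu, hbP hp, hpb h.1.symm]
  · rcases hsub x hx with rfl | rfl | rfl | h
    exacts [⟨a, ha, hz⟩, ⟨a, ha, hu⟩, ⟨c, hc, hcb⟩, ⟨b, hb, h.1.symm⟩]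

/-- A cut-off vertex `c` of a cubic graph with all neighbours in `P`. Only for a reserved set
`{z, u, t}` this is possible without triangles, and then `c`, `z`, `r`, `u` form a 4-cycle. -/
theorem Config.improve_of_subset (hM : Tight G M) (hdeg : ∀ v, #(nbrFinset G v) = 3)
    (h : Config G M P r s) {c : V} (hc : CutOff G P r c) (hsub : nbrFinset G c ⊆ P) :
    ∃ P' r' s', Config G M P' r' s' ∧ #(reach G P r) < #(reach G P' r') := by
  obtain ⟨hrs, hrP, hsP⟩ := h.adj_and_notMem hM
  have hcr : c ≠ r := by
    rintro rfl
    exact hc.2 (SimpleGraph.Reachable.refl c)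
  have hcs : c ≠ s := by
    rintro rfl
    exact hc.2 (SimpleGraph.Adj.reachable ⟨hrs, hrP, hsP⟩)
  have h3 := (hdeg c).symm.le.trans (card_le_card hsub)
  have hcon := h
  cases h with
  | two => have := h3.trans card_le_two; omega
  | @three _ _ z u t h h' =>
    have he := eq_of_subset_of_card_le hsub (card_le_three.trans (hdeg c).symm.le)
    have hz : G.Adj c z := by rw [← mem_nbrFinset, he]; simp
    have hu : G.Adj c u := by rw [← mem_nbrFinset, he]; simp
    have ht : G.Adj c t := by rw [← mem_nbrFinset, he]; simp
    obtain ⟨htz, htu⟩ := h.t_ne hM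
    have hsc := hM.slack c z u r h.zu hcr hz hu h.rz.symm h.ru.symm
    have hsz := hM.slack z r c u hcr.symm h.zu h.rz.symm hz.symm h.ru hu
    refine ⟨_, _, _, .two hsc hsz hz htu.symm hu ht h.zu.symm htz, ?_⟩
    refine hcon.reach_lt hM (.two hsc hsz hz htu.symm hu ht h.zu.symm htz) (p := z) (by simp)
      (by simp [h.zu, htz.symm]) (Or.inl rfl) fun x hx => ⟨c, hc, ?_⟩
    simp only [mem_insert, mem_singleton] at hx
    rcases hx with rfl | rfl <;> assumption
  | @four _ _ z u t v h _ _ _ _ _ _ _ _ _ h4 => have := hdeg r; omega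
  | @five _ _ z u t t₁ t₂ h ht₁ ht₂ hs₁ hs₂ hN h₁₂ hz₁ hu₂ hr =>
    exfalso
    have hct : ¬ G.Adj c t := by
      intro e
      rcases hN c e.symm with rfl | rfl | rfl
      · exact hcs rfl
      · exact hc.1 (by simp)
      · exact hc.1 (by simp)
    obtain ⟨a, b, d, hab, had, hbd, he⟩ := card_eq_three.1 (hdeg c)
    have hmem : ∀ x, G.Adj c x ↔ x = a ∨ x = b ∨ x = d := fun x => by
      rw [← mem_nbrFinset, he]; simp
    have hm : ∀ x, G.Adj c x → x = z ∨ x = u ∨ x = t₁ ∨ x = t₂ := by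
      intro x hx
      have := hsub (mem_nbrFinset.2 hx)
      simp only [mem_insert, mem_singleton] at this
      rcases this with rfl | rfl | rfl | h
      · simp
      · simp
      · exact absurd hx hct
      · tauto
    have n1 : ¬ (G.Adj c t₁ ∧ G.Adj c z) := fun e => hM.triangle_free c t₁ z e.1 hz₁ e.2
    have n2 : ¬ (G.Adj c t₂ ∧ G.Adj c u) := fun e => hM.triangle_free c t₂ u e.1 hu₂ e.2
    have ha := (hmem a).2 (by simp)
    have hb := (hmem b).2 (by simp)
    have hd := (hmem d).2 (by simp)
    have := hm a ha
    have := hm b hb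
    have := hm d hd
    clear hm hmem
    grind

/-- Adjacent cut-off vertices `c` and `a` of a cubic graph with two neighbours in `P` each. The four
neighbours are distinct, hence `z`, `u`, `t₁`, `t₂`, and `c`, `a` together with an edge
`t₁ z` or `t₂ u` form a 4-cycle. -/
theorem Config.improve_of_pair (hM : Tight G M) (hdeg : ∀ v, #(nbrFinset G v) = 3)
    (h : Config G M P r s) {c a p p' b₁ b₂ : V} (hc : CutOff G P r c) (ha : CutOff G P r a)
    (hca : G.Adj c a) (hp : p ∈ P) (hp' : p' ∈ P) (hpp' : p' ≠ p) (hcp : G.Adj c p)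
    (hcp' : G.Adj c p') (hP₁ : b₁ ∈ P) (hP₂ : b₂ ∈ P) (hb : b₁ ≠ b₂) (hb₁ : G.Adj a b₁)
    (hb₂ : G.Adj a b₂) (hne₁ : b₁ ≠ p ∧ b₁ ≠ p') (hne₂ : b₂ ≠ p ∧ b₂ ≠ p') :
    ∃ P' r' s', Config G M P' r' s' ∧ #(reach G P r) < #(reach G P' r') := by
  obtain ⟨hrs, hrP, hsP⟩ := h.adj_and_notMem hM
  have hX : ∀ d, CutOff G P r d → d ≠ r ∧ d ≠ s := by
    rintro d hd
    constructor <;> rintro rfl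
    · exact hd.2 (SimpleGraph.Reachable.refl d)
    · exact hd.2 (SimpleGraph.Adj.reachable ⟨hrs, hrP, hsP⟩)
  have hcon := h
  cases h with
  | two => exfalso; grind
  | three => exfalso; grind
  | four h _ _ _ _ _ _ _ _ _ h4 => have := hdeg r; omega
  | @five _ _ z u t t₁ t₂ h ht₁ ht₂ hs₁ hs₂ hN h₁₂ hz₁ hu₂ hr =>
    have hnt : ∀ d, CutOff G {z, u, t, t₁, t₂} r d → ¬ G.Adj d t := by
      intro d hd e
      rcases hN d e.symm with rfl | rfl | rfl
      · exact (hX _ hd).2 rfl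
      · exact hd.1 (by simp)
      · exact hd.1 (by simp)
    have hm : ∀ d x, CutOff G {z, u, t, t₁, t₂} r d → x ∈ ({z, u, t, t₁, t₂} : Finset V) →
        G.Adj d x → x = z ∨ x = u ∨ x = t₁ ∨ x = t₂ := by
      intro d x hd hx hdx
      simp only [mem_insert, mem_singleton] at hx
      rcases hx with rfl | rfl | rfl | hx
      · simp
      · simp
      · exact absurd hdx (hnt d hd)
      · tauto
    have n1 : ∀ d, ¬ (G.Adj d t₁ ∧ G.Adj d z) := fun d e => hM.triangle_free d t₁ z e.1 hz₁ e.2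
    have n2 : ∀ d, ¬ (G.Adj d t₂ ∧ G.Adj d u) := fun d e => hM.triangle_free d t₂ u e.1 hu₂ e.2
    have n3 : ∀ d, CutOff G {z, u, t, t₁, t₂} r d → ¬ (G.Adj d z ∧ G.Adj d u) := fun d hd e =>
      hr (hM.slack r z u d h.zu (hX d hd).1.symm h.rz h.ru e.1.symm e.2.symm)
    have key : ∀ c d, CutOff G {z, u, t, t₁, t₂} r c → CutOff G {z, u, t, t₁, t₂} r d →
        G.Adj c d → G.Adj c z → G.Adj d t₁ → G.Adj d u →
        ∃ P' r' s', Config G M P' r' s' ∧ #(reach G {z, u, t, t₁, t₂} r) < #(reach G P' r') := by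
      intro c d hc hd hcd hcz hd₁ hdu
      have hc₁ : c ≠ t₁ := fun e => hc.1 (by simp [e])
      have hdz : d ≠ z := fun e => hd.1 (by simp [e])
      have hcu : c ≠ u := fun e => hc.1 (by simp [e])
      have hu₁ : u ≠ t₁ := fun e => hM.triangle_free r u z h.ru (e ▸ hz₁) h.rz
      have hsd := hM.slack d c t₁ z hc₁ hdz hcd.symm hd₁ hcz hz₁
      have hs1 := hM.slack t₁ z d c hdz.symm hc₁.symm hz₁ hd₁.symm hcz.symm hcd.symm
      have hnew : Config G M {c, u} d t₁ := .two hsd hs1 hd₁ hcu hcd.symm hdu hc₁ hu₁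
      refine ⟨_, _, _, hnew, hcon.reach_lt hM hnew (p := t₁) (by simp)
        (by simp [hc₁.symm, hu₁.symm]) (Or.inl rfl) fun x hx => ⟨d, hd, ?_⟩⟩
      simp only [mem_insert, mem_singleton] at hx
      rcases hx with rfl | rfl
      exacts [hcd.symm, hdu]
    -- `c` or `a` is adjacent to `z` and `t₂`, and the other to `u` and `t₁`
    have : (G.Adj c z ∧ G.Adj a t₁ ∧ G.Adj a u) ∨ (G.Adj a z ∧ G.Adj c t₁ ∧ G.Adj c u) := by
      have m1 := hm c p hc hp hcp
      have m2 := hm c p' hc hp' hcp'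
      have := hm a b₁ ha hP₁ hb₁
      have := hm a b₂ ha hP₂ hb₂
      have := n1 c
      have := n1 a
      have := n2 c
      have := n2 a
      have := n3 c hc
      have := n3 a ha
      clear key hm n1 n2 n3 hnt hX hN hp hp' hP₁ hP₂ hc ha
      rcases m1 with rfl | rfl | rfl | rfl <;> rcases m2 with rfl | rfl | rfl | rfl <;> grind
    rcases this with ⟨e1, e2, e3⟩ | ⟨e1, e2, e3⟩
    · exact key c a hc ha hca e1 e2 e3
    · exact key a c ha hc hca.symm e1 e2 e3

/-- The analogue of `Config.improve_of_four_le` for cubic graphs, by the number of neighbours that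
the cut-off vertices `c` and `a` have in `P`. -/
theorem Config.improve_of_cubic (hM : Tight G M) (hdeg : ∀ v, #(nbrFinset G v) = 3)
    (hconn : G.Preconnected) (h : Config G M P r s) {w : V} (hw : CutOff G P r w) :
    ∃ P' r' s', Config G M P' r' s' ∧ #(reach G P r) < #(reach G P' r') := by
  obtain ⟨hrs, hrP, hsP⟩ := h.adj_and_notMem hM
  obtain ⟨p, hp, c, hc, hcp⟩ := exists_boundary hconn hw
  have key : ∃ p' a, p' ∈ P ∧ a ∉ P ∧ G.Adj c p' ∧ G.Adj c a ∧ p' ≠ p ∧ a ≠ p ∨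
      ∃ P' r' s', Config G M P' r' s' ∧ #(reach G P r) < #(reach G P' r') := by
    obtain ⟨a, b, hca, hcb, hab, hap, hbp, hN⟩ := exists_nbrs (hdeg c) hcp
    by_cases haP : a ∈ P <;> by_cases hbP : b ∈ P
    · refine ⟨a, a, Or.inr (h.improve_of_subset hM hdeg hc fun x hx => ?_)⟩
      rcases hN x (by simpa using hx) with rfl | rfl | rfl <;> assumption
    · exact ⟨a, b, Or.inl ⟨haP, hbP, hca, hcb, hap, hbp⟩⟩
    · exact ⟨b, a, Or.inl ⟨hbP, haP, hcb, hca, hbp, hap⟩⟩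
    · exact ⟨a, a, Or.inr (h.improve_of_single hM hdeg hp hc hcp hca hcb hab haP hbP)⟩
  obtain ⟨p', a, ⟨hp', haP, hcp', hca, hpp', hap⟩ | key⟩ := key
  swap
  · exact key
  have ha := hc.of_adj hca haP
  have hnp : ¬ G.Adj a p := fun e => hM.triangle_free c a p hca e hcp
  have hnp' : ¬ G.Adj a p' := fun e => hM.triangle_free c a p' hca e hcp'
  obtain ⟨b₁, b₂, hb₁, hb₂, hb, hbc₁, hbc₂, hN⟩ := exists_nbrs (hdeg a) hca.symm
  by_cases hP₁ : b₁ ∈ P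
  · by_cases hP₂ : b₂ ∈ P
    · have hne₁ : b₁ ≠ p ∧ b₁ ≠ p' := by constructor <;> rintro rfl <;> contradiction
      have hne₂ : b₂ ≠ p ∧ b₂ ≠ p' := by constructor <;> rintro rfl <;> contradiction
      exact h.improve_of_pair hM hdeg hc ha hca hp hp' hpp' hcp hcp' hP₁ hP₂ hb hb₁ hb₂
        hne₁ hne₂
    · exact h.improve_of_single hM hdeg hP₁ ha hb₁ hca.symm hb₂ hbc₂.symm hc.1 hP₂
  by_cases hP₂ : b₂ ∈ P
  · exact h.improve_of_single hM hdeg hP₂ ha hb₂ hca.symm hb₁ hbc₁.symm hc.1 hP₁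
  have hD₁ := ha.of_adj hb₁ hP₁
  have hD₂ := ha.of_adj hb₂ hP₂
  obtain ⟨P', hP', hsub⟩ := exists_config_of_cubic hM
    (⟨hca.symm, hb₁, hb₂, hcp', hb, hbc₁, hbc₂, fun e => haP (e ▸ hp')⟩ :
      ThreeConfig G a c b₁ b₂ p') (hdeg p')
  refine ⟨P', a, c, hP', h.reach_lt hM hP' hp (fun e => ?_) (Or.inr hcp) fun x hx => ?_⟩
  · rcases hsub p e with rfl | rfl | rfl | h
    exacts [hnp hb₁, hnp hb₂, hpp' rfl, hM.triangle_free c p p' hcp h.1 hcp']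
  · rcases hsub x hx with rfl | rfl | rfl | h
    exacts [⟨a, ha, hb₁⟩, ⟨a, ha, hb₂⟩, ⟨c, hc, hcp'⟩,
      h.2.elim (fun e => ⟨b₁, hD₁, e.symm⟩) fun e => ⟨b₂, hD₂, e.symm⟩]

/-- A configuration with the largest reachable set disconnects nothing, by the improvement lemmas.
-/
theorem Tight.hasLabeling (hM : Tight G M) {Δ : ℕ} (hΔ : 3 ≤ Δ)
    (hdeg : ∀ v, #(nbrFinset G v) = Δ) (hconn : G.Connected) : HasLabeling G M := by
  have himp : ∀ P r s w, Config G M P r s → CutOff G P r w →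
      ∃ P' r' s', Config G M P' r' s' ∧ #(reach G P r) < #(reach G P' r') := by
    intro P r s w h hw
    rcases hΔ.eq_or_lt with rfl | h4
    · exact h.improve_of_cubic hM hdeg hconn.preconnected hw
    · exact h.improve_of_four_le hM (fun v => (hdeg v).symm ▸ h4) hconn.preconnected hw
  have hex : ∃ P r s, Config G M P r s := by
    obtain ⟨r⟩ := hconn.nonempty
    obtain ⟨s, z, hs, hz, hsz, -, -⟩ := exists_two_nbrs (G := G) (c := r) ∅
      (by rw [hdeg, card_empty]; omega)
    obtain ⟨z, u, hz, hu, hzu, hzs, hus⟩ := exists_two_nbrs (G := G) (c := r) {s}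
      (by rw [hdeg, card_singleton]; omega)
    obtain ⟨t, v, ht, hv, htv, htr, hvr⟩ := exists_two_nbrs (G := G) (c := s) {r}
      (by rw [hdeg, card_singleton]; omega)
    simp only [mem_singleton] at hzs hus htr hvr
    have h : ThreeConfig G r s z u t := ⟨hs, hz, hu, ht, hzu, hzs, hus, htr⟩
    rcases hΔ.eq_or_lt with rfl | h4
    · obtain ⟨P, hP, -⟩ := exists_config_of_cubic hM h (hdeg t)
      exact ⟨P, r, s, hP⟩
    · obtain ⟨P, hP, -⟩ := exists_config_of_four (M := M) h hv hvr htv ((hdeg r).symm ▸ h4)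
      exact ⟨P, r, s, hP⟩
  suffices ∀ n P r s, Config G M P r s → Fintype.card V ≤ #(reach G P r) + n →
      HasLabeling G M by
    obtain ⟨P, r, s, h⟩ := hex
    exact this _ P r s h (Nat.le_add_left _ _)
  intro n
  induction n with
  | zero =>
    intro P r s h hn
    by_cases hc : ∃ w, CutOff G P r w
    · obtain ⟨w, hw⟩ := hc
      obtain ⟨P', r', s', -, hlt⟩ := himp P r s w h hw
      have := card_le_univ (reach G P' r')
      omega
    · simp only [CutOff, not_exists, not_and, not_not] at hc
      exact h.hasLabeling hM hc
  | succ n ih =>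
    intro P r s h hn
    by_cases hc : ∃ w, CutOff G P r w
    · obtain ⟨w, hw⟩ := hc
      obtain ⟨P', r', s', h', hlt⟩ := himp P r s w h hw
      exact ih P' r' s' h' (by omega)
    · simp only [CutOff, not_exists, not_and, not_not] at hc
      exact h.hasLabeling hM hc

end Connectivity

/-! ### Cycles -/

section Cycle

open Classical

variable {V : Type*} [Fintype V] {G : SimpleGraph V}

/-- The successor of `i` among the indices `0, …, n - 1` of a cycle of length `n`. -/
def cyclicSucc (n i : ℕ) : ℕ := if i + 1 = n then 0 else i + 1

/-- Labels along a cycle of length `n`: repeat `0, 2, 4`, and end with `0, 3, 1, 4` if `n ≡ 1` and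
with `1, 3` if `n ≡ 2` modulo three. -/
def cyclicLabel (n i : ℕ) : ℕ :=
  if n % 3 = 1 ∧ n ≤ i + 4 then (if i + 4 = n then 0 else if i + 3 = n then 3 else
    if i + 2 = n then 1 else 4)
  else if n % 3 = 2 ∧ n ≤ i + 2 then (if i + 2 = n then 1 else 3)
  else 2 * (i % 3)

theorem cyclicLabel_spec {n i : ℕ} (hn : 3 ≤ n) (hi : i < n) :
    cyclicLabel n i < 5 ∧ cyclicLabel n i ≠ cyclicLabel n (cyclicSucc n i) ∧
    cyclicLabel n i ≠ cyclicLabel n (cyclicSucc n i) + 1 ∧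
    cyclicLabel n (cyclicSucc n i) ≠ cyclicLabel n i + 1 ∧
    cyclicLabel n i ≠ cyclicLabel n (cyclicSucc n (cyclicSucc n i)) := by
  have h5 : cyclicLabel n i < 5 := by
    unfold cyclicLabel
    split_ifs <;> omega
  have hs : ∃ j, cyclicSucc n i = j ∧ (i + 1 = n ∧ j = 0 ∨ i + 1 < n ∧ j = i + 1) := by
    refine ⟨_, rfl, ?_⟩
    unfold cyclicSucc
    split_ifs <;> omega
  obtain ⟨j, hj, hij⟩ := hs
  have hs : ∃ k, cyclicSucc n j = k ∧ (j + 1 = n ∧ k = 0 ∨ j + 1 < n ∧ k = j + 1) := by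
    refine ⟨_, rfl, ?_⟩
    unfold cyclicSucc
    split_ifs <;> omega
  obtain ⟨k, hk, hjk⟩ := hs
  rw [hj, hk]
  refine ⟨h5, ?_⟩
  have key : ∀ i, i < n → (n % 3 = 0 ∧ cyclicLabel n i = 2 * (i % 3)) ∨
      (n % 3 = 1 ∧ (i + 4 = n ∧ cyclicLabel n i = 0 ∨ i + 3 = n ∧ cyclicLabel n i = 3 ∨
        i + 2 = n ∧ cyclicLabel n i = 1 ∨ i + 1 = n ∧ cyclicLabel n i = 4 ∨
        i + 4 < n ∧ cyclicLabel n i = 2 * (i % 3))) ∨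
      (n % 3 = 2 ∧ (i + 2 = n ∧ cyclicLabel n i = 1 ∨ i + 1 = n ∧ cyclicLabel n i = 3 ∨
        i + 2 < n ∧ cyclicLabel n i = 2 * (i % 3))) := by
    intro i hi
    unfold cyclicLabel
    split_ifs <;> omega
  have h1 := key i hi
  have h2 := key j (by omega)
  have h3 := key k (by omega)
  clear key
  generalize cyclicLabel n i = a at *
  generalize cyclicLabel n j = b at *
  generalize cyclicLabel n k = c at *
  rcases h1 with ⟨h, h1⟩ | ⟨h, h1 | h1 | h1 | h1 | h1⟩ | ⟨h, h1 | h1 | h1⟩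
  all_goals
    rcases hij with hij | hij <;> first | (exfalso; omega) | rcases hjk with hjk | hjk <;>
    first
      | (exfalso; omega)
      | rcases h2 with ⟨h', h2⟩ | ⟨h', h2 | h2 | h2 | h2 | h2⟩ | ⟨h', h2 | h2 | h2⟩ <;>
        first
          | (exfalso; omega)
          | rcases h3 with ⟨h'', h3⟩ | ⟨h'', h3 | h3 | h3 | h3 | h3⟩ | ⟨h'', h3 | h3 | h3⟩ <;>
            first
              | (exfalso; omega)
              | refine ⟨?_, ?_, ?_, ?_⟩ <;> omega

/-- A connected 2-regular graph is a single closed cycle, along which `cyclicLabel` is a labeling.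
-/
theorem hasLabeling_of_two_regular (hdeg : ∀ v, #(nbrFinset G v) = 2) (hconn : G.Connected) :
    HasLabeling G 5 := by
  have hns : ∀ v, G.neighborSet v = nbrFinset G v := fun v => by ext w; simp
  have hcyc : G.IsCycles := fun v _ => by rw [hns, Set.ncard_coe_finset, hdeg]
  obtain ⟨v⟩ := hconn.nonempty
  obtain ⟨p, hp, hverts⟩ := hcyc.exists_cycle_toSubgraph_verts_eq_connectedComponentSupp
    (v := v) (c := G.connectedComponentMk v) rfl
    (by rw [hns, coe_nonempty, ← card_pos, hdeg]; omega)
  have hsurj : ∀ w, ∃ i, i < p.length ∧ p.getVert i = w := by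
    intro w
    have hw : w ∈ p.support := by
      rw [← SimpleGraph.Walk.mem_verts_toSubgraph, hverts]
      exact SimpleGraph.ConnectedComponent.sound (hconn.preconnected w v)
    obtain ⟨i, hi, hi'⟩ := SimpleGraph.Walk.mem_support_iff_exists_getVert.1 hw
    rcases hi'.lt_or_eq with h | h
    · exact ⟨i, h, hi⟩
    · exact ⟨0, by have := hp.three_le_length; omega, by simpa [h] using hi⟩
  choose idx hlt hidx using hsurj
  have hn := hp.three_le_length
  set n := p.length with hn'
  have hinj : ∀ i j, i < n → j < n → p.getVert i = p.getVert j → i = j := fun i j hi hj h =>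
    hp.getVert_injOn' (by simp; omega) (by simp; omega) h
  have hgs : ∀ i, i < n → p.getVert (i + 1) = p.getVert (cyclicSucc n i) := by
    intro i hi
    unfold cyclicSucc
    split_ifs with h
    · rw [h, hn', p.getVert_length, p.getVert_zero]
    · rfl
  have hslt : ∀ i, i < n → cyclicSucc n i < n := by
    intro i hi
    unfold cyclicSucc
    split_ifs <;> omega
  have hsinj : ∀ i j, i < n → j < n → cyclicSucc n i = cyclicSucc n j → i = j := by
    intro i j hi hj h
    unfold cyclicSucc at h
    split_ifs at h <;> omega
  have hsadj : ∀ i, i < n → G.Adj (p.getVert i) (p.getVert (cyclicSucc n i)) := fun i hi =>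
    hgs i hi ▸ p.adj_getVert_succ hi
  -- each vertex has a cyclic predecessor
  have hpred : ∀ i, i < n → ∃ j, j < n ∧ cyclicSucc n j = i := by
    intro i hi
    by_cases h : i = 0
    · exact ⟨n - 1, by omega, by unfold cyclicSucc; split_ifs <;> omega⟩
    · exact ⟨i - 1, by omega, by unfold cyclicSucc; split_ifs <;> omega⟩
  have hadj : ∀ x y, G.Adj x y → idx y = cyclicSucc n (idx x) ∨ idx x = cyclicSucc n (idx y) := by
    intro x y hxy
    obtain ⟨j, hj, hji⟩ := hpred (idx x) (hlt x)
    have h1 := hsadj (idx x) (hlt x)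
    have h2 := hsadj j hj
    rw [hji] at h2
    rw [hidx] at h1 h2
    have hne : p.getVert (cyclicSucc n (idx x)) ≠ p.getVert j := by
      intro h
      have := hinj _ _ (hslt _ (hlt x)) hj h
      rw [← hji] at this
      unfold cyclicSucc at this
      split_ifs at this <;> omega
    have hsub : {p.getVert (cyclicSucc n (idx x)), p.getVert j} = nbrFinset G x := by
      refine eq_of_subset_of_card_le ?_ (by rw [card_pair hne, hdeg])
      intro w hw
      simp only [mem_insert, mem_singleton] at hw
      rw [mem_nbrFinset]
      rcases hw with rfl | rfl
      exacts [h1, h2.symm]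
    have hy : y ∈ nbrFinset G x := by simpa using hxy
    rw [← hsub] at hy
    simp only [mem_insert, mem_singleton] at hy
    rcases hy with h | h
    · left
      exact hinj _ _ (hlt y) (hslt _ (hlt x)) (by rw [hidx, h])
    · right
      rw [← hji]
      congr 1
      exact (hinj _ _ (hlt y) hj (by rw [hidx, h])).symm
  refine ⟨fun x => cyclicLabel n (idx x), fun x => (cyclicLabel_spec hn (hlt x)).1, ?_, ?_⟩
  · rintro x y ⟨hxy, h | ⟨m, h1, h2⟩⟩
    · have sx := cyclicLabel_spec hn (hlt x)
      have sy := cyclicLabel_spec hn (hlt y)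
      rcases hadj x y h with h | h
      · rw [← h] at sx; exact sx.2.1
      · rw [← h] at sy; exact sy.2.1.symm
    · have sx := (cyclicLabel_spec hn (hlt x)).2.2.2.2
      have sy := (cyclicLabel_spec hn (hlt y)).2.2.2.2
      have hne : idx x ≠ idx y := fun e => hxy (by rw [← hidx x, ← hidx y, e])
      rcases hadj x m h1 with e1 | e1 <;> rcases hadj m y h2 with e2 | e2
      · rw [← e1, ← e2] at sx; exact sx
      · exact absurd (hsinj _ _ (hlt x) (hlt y) (e1.symm.trans e2)) hne
      · exact absurd (e1.trans e2.symm) hne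
      · rw [← e2, ← e1] at sy; exact sy.symm
  · intro x y h
    have sx := cyclicLabel_spec hn (hlt x)
    have sy := cyclicLabel_spec hn (hlt y)
    rcases hadj x y h with h | h
    · rw [← h] at sx; exact sx.2.2.2.1
    · rw [← h] at sy; exact sy.2.2.1

end Cycle

/-! ### Labelings for arbitrary graphs -/

section Reduction

open Classical

variable {V : Type*} {G : SimpleGraph V}

theorem hasLabeling_of_components {M : ℕ}
    (h : ∀ C : G.ConnectedComponent, HasLabeling C.toSimpleGraph M) : HasLabeling G M := by
  choose f hlt hnear hadj using h
  let g : V → ℕ := fun v => f (G.connectedComponentMk v) ⟨v, rfl⟩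
  have hg : ∀ (C : G.ConnectedComponent) (w : V) (hw : w ∈ C), g w = f C ⟨w, hw⟩ := by
    rintro C w rfl
    rfl
  have hmem : ∀ v w, G.Adj v w → ∀ C : G.ConnectedComponent, v ∈ C → w ∈ C := fun v w h C hv =>
    (SimpleGraph.ConnectedComponent.sound h.symm.reachable).trans hv
  refine ⟨g, fun v => hlt _ _, ?_, ?_⟩
  · rintro v w ⟨hne, h⟩
    have hv : v ∈ G.connectedComponentMk v := rfl
    have hw : w ∈ G.connectedComponentMk v := by
      rcases h with h | ⟨x, h1, h2⟩
      · exact hmem v w h _ hv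
      · exact hmem x w h2 _ (hmem v x h1 _ hv)
    rw [hg _ v hv, hg _ w hw]
    refine hnear _ _ _ ⟨fun e => hne (congrArg Subtype.val e), ?_⟩
    rcases h with h | ⟨x, h1, h2⟩
    · exact Or.inl h
    · exact Or.inr ⟨⟨x, hmem v x h1 _ hv⟩, h1, h2⟩
  · intro v w h
    have hv : v ∈ G.connectedComponentMk v := rfl
    have hw := hmem v w h _ hv
    rw [hg _ v hv, hg _ w hw]
    exact hadj _ _ _ h

variable [Fintype V]

/-- The case without reserved vertices: `s` comes last but one, with `r` after it, and `r` comes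
last with nothing after it. -/
theorem hasLabeling_of_adj (hconn : G.Connected) {M : ℕ}
    (hM : ∀ v, #(nearFinset G v) + #(nbrFinset G v) ≤ M + 1) {r s : V} (hrs : G.Adj r s)
    (hs : Slack G M s) (hr : #(nearFinset G r) + #(nbrFinset G r) < M) : HasLabeling G M := by
  have havoid : avoid G ∅ = G := by
    ext v w
    simp [avoid]
  obtain ⟨rank, Λ, F⟩ := exists_frame (P := ∅) hrs (by simp) (by simp)
    fun v _ => havoid.symm ▸ hconn.preconnected r v
  refine F.hasLabeling F.stage_zero (Nat.zero_le _) hM [s, r] (by simp [hrs.ne.symm])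
    (by simp) (by simp) (by simp)
    (.cons_one hs [r] [] (by simp) (by simp [hrs.symm.near])
      (.cons 0 [] [] (by omega) (by simp) (by simp) .nil)) (by simp)

/-- A vertex of small degree or a triangle provides a last edge for the plain greedy order; what
remains are cycles and triangle-free regular graphs of degree at least three. -/
theorem hasLabeling_of_connected {Δ : ℕ} (hΔ : 2 ≤ Δ) (hdeg : ∀ v, #(nbrFinset G v) ≤ Δ)
    (hconn : G.Connected) : HasLabeling G (Δ ^ 2 + Δ - 1) := by
  have hsum : ∀ v, ∑ w ∈ nbrFinset G v, #(nbrFinset G w) ≤ #(nbrFinset G v) * Δ := fun v => by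
    simpa using sum_le_card_nsmul (nbrFinset G v) (fun w => #(nbrFinset G w)) Δ fun w _ => hdeg w
  have hsq : ∀ v, #(nbrFinset G v) * Δ ≤ Δ ^ 2 := fun v => by
    rw [pow_two]
    exact Nat.mul_le_mul_right Δ (hdeg v)
  have hM : ∀ v, #(nearFinset G v) + #(nbrFinset G v) ≤ (Δ ^ 2 + Δ - 1) + 1 := by
    intro v
    have := card_near_le (G := G) v
    have := hsum v
    have := hsq v
    have := hdeg v
    omega
  by_cases hE : ∃ a b, G.Adj a b
  swap
  · push Not at hE
    have : 4 ≤ Δ ^ 2 := by nlinarith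
    exact ⟨fun _ => 0, fun _ => by dsimp only; omega, fun v w h => absurd h.2 (by simp [hE]),
      fun v w h => absurd h (hE v w)⟩
  obtain ⟨a, b, hab⟩ := hE
  by_cases hreg : ∀ v, #(nbrFinset G v) = Δ
  swap
  · push Not at hreg
    obtain ⟨r, hr⟩ := hreg
    replace hr : #(nbrFinset G r) + 1 ≤ Δ := lt_of_le_of_ne (hdeg r) hr
    have hex : ∃ s, G.Adj r s := by
      by_cases h : r = a
      · exact ⟨b, h ▸ hab⟩
      · obtain ⟨s, hs, -⟩ := exists_adj_dist_succ (hconn.preconnected a r) (Ne.symm h)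
        exact ⟨s, hs⟩
    obtain ⟨s, hrs⟩ := hex
    have hr2 : (#(nbrFinset G r) + 1) * Δ ≤ Δ ^ 2 := by
      rw [pow_two]
      exact Nat.mul_le_mul_right Δ hr
    rw [add_mul] at hr2
    refine hasLabeling_of_adj hconn hM hrs ?_ ?_
    · have h1 := card_near_le (G := G) s
      have hrs' : r ∈ nbrFinset G s := by simpa using hrs.symm
      rw [← add_sum_erase _ _ hrs'] at h1
      have h2 := sum_le_card_nsmul ((nbrFinset G s).erase r) (fun w => #(nbrFinset G w)) Δ
        fun w _ => hdeg w
      have h3 : (#((nbrFinset G s).erase r) + 1) * Δ ≤ Δ ^ 2 := by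
        rw [card_erase_add_one hrs']
        exact hsq s
      rw [add_mul] at h3
      simp only [smul_eq_mul] at h2
      have := hdeg s
      unfold Slack
      omega
    · have := card_near_le (G := G) r
      have := hsum r
      omega
  by_cases htri : ∃ a b c, G.Adj a b ∧ G.Adj b c ∧ G.Adj a c
  · obtain ⟨a, b, c, hab, hbc, hac⟩ := htri
    have key : ∀ v x y, G.Adj v x → G.Adj v y → G.Adj x y →
        #(nearFinset G v) + #(nbrFinset G v) < Δ ^ 2 + Δ - 1 := by
      intro v x y hx hy hxy
      have h1 := card_near_add_le hx hy hxy.ne {x, y} (by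
        intro w hw
        simp only [mem_insert, mem_singleton] at hw
        rcases hw with rfl | rfl
        · exact ⟨hx.ne.symm, Or.inl rfl, Or.inr hxy.symm⟩
        · exact ⟨hy.ne.symm, Or.inr hxy, Or.inl rfl⟩)
      rw [card_pair hxy.ne] at h1
      have := hsum v
      have := hsq v
      have := hdeg v
      omega
    exact hasLabeling_of_adj hconn hM hab (key b a c hab.symm hbc hac).le (key a b c hab hac hbc)
  push Not at htri
  rcases hΔ.eq_or_lt with rfl | h3
  · exact hasLabeling_of_two_regular hreg hconn
  refine Tight.hasLabeling ⟨hM, ?_, htri, ?_⟩ h3 hreg hconn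
  · intro v a b x hab hvx hva hvb hax hbx
    have h1 := card_near_add_le hva hvb hab {x} (by
      intro w hw
      rw [mem_singleton] at hw
      subst hw
      exact ⟨hvx.symm, Or.inr hax, Or.inr hbx⟩)
    rw [card_singleton] at h1
    have := hsum v
    have := hsq v
    have := hdeg v
    unfold Slack
    omega
  · have : 4 ≤ Δ ^ 2 := by nlinarith
    omega

theorem hasLabeling_of_degree_le {Δ : ℕ} (hΔ : 2 ≤ Δ) (hdeg : ∀ v, #(nbrFinset G v) ≤ Δ) :
    HasLabeling G (Δ ^ 2 + Δ - 1) := by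
  refine hasLabeling_of_components fun C => hasLabeling_of_connected hΔ (fun v => ?_)
    C.connected_toSimpleGraph
  refine le_trans (card_le_card_of_injOn Subtype.val (fun w hw => ?_)
    Subtype.val_injective.injOn) (hdeg v.1)
  simp only [mem_coe, mem_nbrFinset] at hw ⊢
  exact hw

end Reduction

/-! ### Anti-`L_d(2,1)`-labelings -/

section Labelings

variable {V : Type*} {G : SimpleGraph V} {k : ℕ}

theorem near_of_dist_eq_two {x y : V} (h : G.dist x y = 2) : Near G x y := by
  have hne : x ≠ y := by
    rintro rfl
    simp at h
  have hr : G.Reachable x y := SimpleGraph.Reachable.of_dist_ne_zero (by omega)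
  obtain ⟨p, hp⟩ := hr.exists_walk_length_eq_dist
  rw [h] at hp
  refine ⟨hne, Or.inr ⟨p.getVert 1, ?_, ?_⟩⟩
  · simpa using p.adj_getVert_succ (i := 0) (by omega)
  · have := p.adj_getVert_succ (i := 1) (by omega)
    rwa [show 1 + 1 = p.length by omega, p.getVert_length] at this

/-- Stretching a labeling by the factor `d` and shifting it by one. -/
theorem HasLabeling.isAntiL21Labeling {L : ℕ} (h : HasLabeling G (L + 1)) {d : ℤ} (hd : 0 ≤ d)
    (hk : 1 + d * L ≤ k) : ∃ f : V → ℤ, IsAntiL21Labeling G k d f := by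
  obtain ⟨f, hlt, hnear, hadj⟩ := h
  have habs : ∀ x y, ((1 + d * f x) - (1 + d * f y) : ℤ) = d * (f x - f y) := fun x y => by ring
  refine ⟨fun v => 1 + d * f v, fun x => ⟨?_, ?_⟩, fun x y hxy => ?_, fun x y hxy => ?_⟩
  · have : 0 ≤ d * f x := by positivity
    linarith
  · have : d * f x ≤ d * L := by
      have : f x ≤ L := Nat.lt_succ_iff.1 (hlt x)
      gcongr
    push_cast
    linarith
  · rw [habs, abs_mul, abs_of_nonneg hd, mul_comm]
    refine mul_le_mul_of_nonneg_left ?_ hd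
    have h1 := hnear x y hxy.near
    have h2 := hadj x y hxy
    have h3 := hadj y x hxy.symm
    rw [le_abs]
    omega
  · rw [habs, abs_mul, abs_of_nonneg hd]
    refine le_mul_of_one_le_right hd ?_
    have h1 := hnear x y (near_of_dist_eq_two hxy)
    rw [le_abs]
    omega

theorem IsAntiL21Labeling.intCast {d : ℤ} {f : V → ℤ} (h : IsAntiL21Labeling G k d f) :
    IsAntiL21Labeling G k (d : ℝ) fun v => (f v : ℝ) := by
  refine ⟨fun x => ⟨?_, ?_⟩, fun x y hxy => ?_, fun x y hxy => ?_⟩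
  · dsimp only; exact_mod_cast (h.1 x).1
  · dsimp only; exact_mod_cast (h.1 x).2
  · dsimp only; exact_mod_cast h.2.1 x y hxy
  · dsimp only; exact_mod_cast h.2.2 x y hxy

theorem le_of_mem_antiL21Values {R : Type*} [Ring R] [LinearOrder R] [IsStrictOrderedRing R]
    {a b : V} (hab : G.Adj a b) {m : R} (hm : m ∈ antiL21Values R G k) : m ≤ k := by
  obtain ⟨d, -, rfl, f, hf⟩ := hm
  refine (hf.2.1 a b hab).trans ?_
  have ha := hf.1 a
  have hb := hf.1 b
  have h1 : (0 : R) ≤ 1 := zero_le_one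
  rw [abs_le]
  constructor
  · have := hb.2.trans (le_add_of_nonneg_right (h1.trans ha.1))
    rw [neg_le_sub_iff_le_add]
    rwa [add_comm]
  · exact (sub_le_self _ (h1.trans hb.1)).trans ha.2

/-- The pairs of a number `d` and a labeling form a compact set, `d` being bounded because `G` has
an edge. -/
theorem isCompact_antiL21Values [Finite V] {a b : V} (hab : G.Adj a b) :
    IsCompact (antiL21Values ℝ G k) := by
  let K : Set (ℝ × (V → ℝ)) := Set.Icc 0 (k : ℝ) ×ˢ Set.univ.pi fun _ => Set.Icc 1 (k : ℝ)
  let A : Set (ℝ × (V → ℝ)) := {p | ∀ x y, G.Adj x y → 2 * p.1 ≤ |p.2 x - p.2 y|} ∩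
    {p | ∀ x y, G.dist x y = 2 → p.1 ≤ |p.2 x - p.2 y|}
  have hK : IsCompact K := isCompact_Icc.prod (isCompact_univ_pi fun _ => isCompact_Icc)
  have hA : IsClosed A := by
    refine IsClosed.inter ?_ ?_ <;> simp only [Set.ofPred_forall] <;>
      refine isClosed_iInter fun x => isClosed_iInter fun y => isClosed_iInter fun _ =>
        isClosed_le (by fun_prop) (by fun_prop)
  have himage : antiL21Values ℝ G k = (fun p : ℝ × (V → ℝ) => 2 * p.1) '' (K ∩ A) := by
    ext m
    constructor
    · intro hm
      have hle := le_of_mem_antiL21Values hab hm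
      obtain ⟨d, hd, rfl, f, hf⟩ := hm
      exact ⟨(d, f), ⟨⟨⟨hd, by dsimp only; linarith⟩, fun x _ => hf.1 x⟩, hf.2.1, hf.2.2⟩, rfl⟩
    · rintro ⟨⟨d, f⟩, ⟨⟨hd, hf⟩, h1, h2⟩, rfl⟩
      exact ⟨d, hd.1, rfl, f, fun x => hf x trivial, h1, h2⟩
  rw [himage]
  exact (hK.inter_right hA).image (by fun_prop)

end Labelings

theorem mainTheorem11 {V : Type*} [Fintype V] (G : SimpleGraph V) [DecidableRel G.Adj]
    (hΔ : 2 ≤ G.maxDegree) (k : ℕ) (hk : 1 ≤ k) :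
    (IsGreatest (antiL21Values ℝ G k) (antiL21Number ℝ G k) ∧
      2 * (⌊((k : ℝ) - 1) / ((G.maxDegree : ℝ) ^ 2 + (G.maxDegree : ℝ) - 2)⌋ : ℝ)
        ≤ antiL21Number ℝ G k) ∧
    (IsGreatest (antiL21Values ℤ G k) (antiL21Number ℤ G k) ∧
      2 * ⌊((k : ℝ) - 1) / ((G.maxDegree : ℝ) ^ 2 + (G.maxDegree : ℝ) - 2)⌋
        ≤ antiL21Number ℤ G k) := by
  set Δ := G.maxDegree with hΔ'
  have hdeg : ∀ v, #(nbrFinset G v) ≤ Δ := by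
    intro v
    rw [hΔ', ← show G.degree v = #(nbrFinset G v) by
      rw [← SimpleGraph.card_neighborFinset_eq_degree]
      congr 1
      ext w
      simp]
    exact G.degree_le_maxDegree v
  obtain ⟨a, b, hab⟩ : ∃ a b, G.Adj a b := by
    by_contra! h
    have : G.maxDegree ≤ 0 := G.maxDegree_le_of_forall_degree_le 0 fun v => by
      rw [← SimpleGraph.card_neighborFinset_eq_degree, Nat.le_zero, card_eq_zero]
      ext w
      simp [h v w]
    omega
  have hlab := hasLabeling_of_degree_le hΔ hdeg
  have h4 : 4 ≤ Δ ^ 2 := by nlinarith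
  rw [show Δ ^ 2 + Δ - 1 = (Δ ^ 2 + Δ - 2) + 1 by omega] at hlab
  have hL : ((Δ ^ 2 + Δ - 2 : ℕ) : ℝ) = (Δ : ℝ) ^ 2 + (Δ : ℝ) - 2 := by
    rw [Nat.cast_sub (by omega)]
    push_cast
    ring
  rw [← hL]
  set L := Δ ^ 2 + Δ - 2
  have hLpos : (0 : ℝ) < L := by
    have : 0 < L := by omega
    exact_mod_cast this
  set d := ⌊((k : ℝ) - 1) / (L : ℝ)⌋
  have hk' : (1 : ℝ) ≤ k := by exact_mod_cast hk
  have hd : 0 ≤ d := Int.floor_nonneg.2 (div_nonneg (by linarith) hLpos.le)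
  have hdL : 1 + d * L ≤ (k : ℤ) := by
    have h1 : (d : ℝ) ≤ ((k : ℝ) - 1) / L := Int.floor_le _
    rw [le_div_iff₀ hLpos] at h1
    have : (1 : ℝ) + d * L ≤ k := by linarith
    exact_mod_cast this
  obtain ⟨f, hf⟩ := hlab.isAntiL21Labeling hd hdL
  have hZ : 2 * d ∈ antiL21Values ℤ G k := ⟨d, hd, rfl, f, hf⟩
  have hR : 2 * (d : ℝ) ∈ antiL21Values ℝ G k :=
    ⟨d, by exact_mod_cast hd, rfl, _, hf.intCast⟩
  have hbZ : BddAbove (antiL21Values ℤ G k) := ⟨k, fun m hm => le_of_mem_antiL21Values hab hm⟩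
  have hbR : BddAbove (antiL21Values ℝ G k) := ⟨k, fun m hm => le_of_mem_antiL21Values hab hm⟩
  exact ⟨⟨⟨(isCompact_antiL21Values hab).sSup_mem ⟨_, hR⟩, fun m hm => le_csSup hbR hm⟩,
    le_csSup hbR hR⟩, ⟨⟨Int.csSup_mem ⟨_, hZ⟩ hbZ, fun m hm => le_csSup hbZ hm⟩, le_csSup hbZ hZ⟩⟩
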